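/- **Theorem 3.1 (Model Uniqueness).** Let $d\in\{2,3\}$, let $\Omega\subset\mathbb R^d$ be a nonempty bounded open set with diameter $L$ and volume $|\Omega|$, let $\nu,\tau,T>0$, and let $\mu(y)=0.55\,(y/L)^2$, where $y$ is the distance of $x\in\Omega$ to $\partial\Omega$. Let $V=\{u\in H_0^1(\Omega)^d:\nabla\cdot u=0\}$, where $H_0^1(\Omega)$ is the closure of $C_c^\infty(\Omega)$ in $H^1(\Omega)$, and let $V'$ be its dual. Let $f\in L^2(0,T;L^2(\Omega)^d)$, $v_0\in L^2(\Omega)^d$ and $k_0\ge 0$. Write $\nabla^s v$ for the symmetric part of $\nabla v$, $(\cdot,\cdot)$ and $\|\cdot\|$ for the inner product and the norm of $L^2(\Omega)$. A pair $(v,k)$ is called a strong solution on $[0,T]$, with data $(f,v_0,k_0)$, of the $1/2$-equation model $$v_t+v\cdot\nabla v-\nabla\cdot\big([2\nu+\mu(y)k(t)\tau]\nabla^s v\big)+\nabla p=f,\quad \nabla\cdot v=0 \text{ in }\Omega,\quad v=0\text{ on }\partial\Omega,$$ $$\frac{d}{dt}k(t)+\frac{\sqrt2}{2}\tau^{-1}k(t)=\frac1{|\Omega|}\int_\Omega\mu(y)k(t)\tau|\nabla^s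 v(x,t)|^2\,dx,$$ if $v\in L^2(0,T;V)$ has a time derivative $v_t\in L^2(0,T;V')$, $v(0)=v_0$ in the sense that, for almost every $t\in[0,T]$, $(v(t),w)=(v_0,w)+\int_0^t\langle v_t(s),w\rangle\,ds$ for all $w\in V$; for almost every $t\in[0,T]$ and all $w\in V$, $$\langle v_t,w\rangle+(v\cdot\nabla v,w)+\int_\Omega[2\nu+\mu(y)k(t)\tau]\,\nabla^s v:\nabla^s w\,dx=(f,w);$$ and $k$ is absolutely continuous on $[0,T]$, $k(0)=k_0$, and $k$ satisfies its equation for almost every $t\in[0,T]$. Suppose that $(v_1,k_1)$ is a strong solution with $$\int_0^T\|\nabla v_1(t)\|^4\,dt<\infty .$$ Then it is the only strong solution with its data: if $(v_2,k_2)$ is any strong solution with the same data $(f,v_0,k_0)$, then $v_1(t)=v_2(t)$ for almost every $t\in[0,T]$ and $k_1(t)=k_2(t)$ for all $t\in[0,T]$. -/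

import Mathlib

open MeasureTheory Set
open scoped ContDiff

noncomputable section

namespace HalfEq

variable {d : ℕ}

/-- Physical space `ℝ^d` with the Euclidean norm and Lebesgue measure. -/
abbrev Space (d : ℕ) : Type := EuclideanSpace ℝ (Fin d)

/-- The real Lebesgue space `L²(Ω)`. -/
abbrev L2 (Ω : Set (Space d)) : Type := Lp ℝ 2 (volume.restrict Ω)

/-- The classical partial derivative `∂φ/∂x_j`. -/
def pderiv (φ : Space d → ℝ) (j : Fin d) (x : Space d) : ℝ :=
  fderiv ℝ φ x (EuclideanSpace.single j 1)

/-- `φ ∈ C_c^∞(Ω)`. -/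
def IsTest (Ω : Set (Space d)) (φ : Space d → ℝ) : Prop :=
  ContDiff ℝ ∞ φ ∧ HasCompactSupport φ ∧ tsupport φ ⊆ Ω

/-- The pairs `(φ, ∇φ) ∈ L²(Ω) × L²(Ω)^d` with `φ ∈ C_c^∞(Ω)`. -/
def testGraph (Ω : Set (Space d)) : Set (L2 Ω × (Fin d → L2 Ω)) :=
  {p | ∃ φ : Space d → ℝ, IsTest Ω φ ∧ p.1 =ᵐ[volume.restrict Ω] φ ∧
    ∀ j, p.2 j =ᵐ[volume.restrict Ω] pderiv φ j}

/-- The Sobolev space `H₀¹(Ω)`, the closure of `C_c^∞(Ω)` in the `H¹` norm. A function `u` of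
`H₀¹(Ω)` is represented by the pair `(u, ∇u)` in `L²(Ω) × L²(Ω)^d`; the norm inherited from the
product is equivalent to the usual `H¹` norm. -/
def H10 (Ω : Set (Space d)) : Submodule ℝ (L2 Ω × (Fin d → L2 Ω)) :=
  (Submodule.span ℝ (testGraph Ω)).topologicalClosure

/-- The space `L²(Ω)^d × L²(Ω)^(d × d)` of the pairs `(u, ∇u)`; the entry `(i, j)` of the second
component stands for `∂_j u_i`. -/
abbrev Pairs (Ω : Set (Space d)) : Type := (Fin d → L2 Ω) × (Fin d → Fin d → L2 Ω)

/-- The velocity space `W = H₀¹(Ω)^d`, its fields `u` represented by the pairs `(u, ∇u)`. -/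
def W (Ω : Set (Space d)) : Submodule ℝ (Pairs Ω) where
  carrier := {u | ∀ i, (u.1 i, u.2 i) ∈ H10 Ω}
  add_mem' := fun ha hb i => (H10 Ω).add_mem (ha i) (hb i)
  zero_mem' := fun _ => (H10 Ω).zero_mem
  smul_mem' := fun c _ ha i => (H10 Ω).smul_mem c (ha i)

/-- The subspace of the fields `u ∈ W` with `∇ · u = ∑ i, ∂_i u_i = 0`. -/
def divFree (Ω : Set (Space d)) : Submodule ℝ (Pairs Ω) where
  carrier := {u | u ∈ W Ω ∧ ∑ i, u.2 i i = 0}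
  add_mem' := fun ha hb => ⟨(W Ω).add_mem ha.1 hb.1, by
    simp [Finset.sum_add_distrib, ha.2, hb.2]⟩
  zero_mem' := ⟨(W Ω).zero_mem, by simp⟩
  smul_mem' := fun c _ ha => ⟨(W Ω).smul_mem c ha.1, by
    simp [← Finset.smul_sum, ha.2]⟩

/-- The normed space `V` of the divergence-free fields of `W`. -/
def V (Ω : Set (Space d)) : Type := divFree Ω

instance (Ω : Set (Space d)) : NormedAddCommGroup (V Ω) :=
  inferInstanceAs (NormedAddCommGroup (divFree Ω))

instance (Ω : Set (Space d)) : NormedSpace ℝ (V Ω) :=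
  inferInstanceAs (NormedSpace ℝ (divFree Ω))

section Fields

variable {Ω : Set (Space d)}

/-- The component `u_i` of a field `u ∈ V`. -/
def comp (u : V Ω) (i : Fin d) : L2 Ω := u.1.1 i

/-- The weak derivative `∂_j u_i` of a field `u ∈ V`. -/
def dcomp (u : V Ω) (i j : Fin d) : L2 Ω := u.1.2 i j

/-- The entry `(i, j)` of the symmetric gradient `∇ˢu = (∇u + ∇uᵀ) / 2` at the point `x`. -/
def symGrad (u : V Ω) (i j : Fin d) (x : Space d) : ℝ := (dcomp u i j x + dcomp u j i x) / 2

/-- The `L²` norm `‖∇u‖` of the full gradient. -/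
def gradNorm (u : V Ω) : ℝ := √(∑ i, ∑ j, ∫ x in Ω, (dcomp u i j x) ^ 2)

/-- The pairing `(g, w) = ∫_Ω g · w` of a square-integrable vector field with `w ∈ V`. -/
def pair (g : Fin d → L2 Ω) (w : V Ω) : ℝ := ∑ i, ∫ x in Ω, g i x * comp w i x

/-- The convection term `((u · ∇) v, w)`. -/
def conv (u v w : V Ω) : ℝ := ∫ x in Ω, ∑ i, ∑ j, comp u j x * dcomp v i j x * comp w i x

end Fields

/-- `μ(y) = 0.55 (y / L)²`, where `y` is the distance of `x` to the wall `∂Ω` and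
`L` is the diameter of `Ω`. -/
def mu (Ω : Set (Space d)) (x : Space d) : ℝ :=
  0.55 * (Metric.infDist x (frontier Ω) / Metric.diam Ω) ^ 2

/-- The viscous term `∫_Ω [2ν + μ(y) κ τ] ∇ˢv : ∇ˢw`, where `κ` is the value of `k`. -/
def visc (Ω : Set (Space d)) (ν τ κ : ℝ) (v w : V Ω) : ℝ :=
  ∫ x in Ω, (2 * ν + mu Ω x * κ * τ) * ∑ i, ∑ j, symGrad v i j x * symGrad w i j x

/-- The source `(1 / |Ω|) ∫_Ω μ(y) κ τ |∇ˢv|²` of the `k`-equation. -/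
def dissip (Ω : Set (Space d)) (τ κ : ℝ) (v : V Ω) : ℝ :=
  (1 / volume.real Ω) * ∫ x in Ω, mu Ω x * κ * τ * ∑ i, ∑ j, (symGrad v i j x) ^ 2

/-- `(v, k)` is a strong solution on `[0, T]` of the `1/2`-equation model
`v_t + v · ∇v - ∇ · ([2ν + μ(y) k τ] ∇ˢv) + ∇p = f`, `∇ · v = 0`, `v = 0` on `∂Ω`,
`k' + (√2 / 2) τ⁻¹ k = (1 / |Ω|) ∫_Ω μ(y) k τ |∇ˢv|²`, with initial data `v(0) = v₀`, `k(0) = k₀`: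
`v ∈ L²(0,T;V)` has a time derivative `vt ∈ L²(0,T;V')`, and the momentum equation
holds in `V'` for almost every time (the pressure is absent since fields in `V` are
divergence-free); `k` is absolutely continuous and its equation holds for almost every time. -/
structure IsStrongSolution (Ω : Set (Space d)) (ν τ T : ℝ) (f : ℝ → Fin d → L2 Ω)
    (v₀ : Fin d → L2 Ω) (k₀ : ℝ) (v : ℝ → V Ω) (k : ℝ → ℝ) : Prop where
  memLp : MemLp v 2 (volume.restrict (Icc 0 T))
  momentum : ∃ vt : ℝ → StrongDual ℝ (V Ω),
    MemLp vt 2 (volume.restrict (Icc 0 T)) ∧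
    (∀ᵐ t ∂(volume.restrict (Icc 0 T)), ∀ w : V Ω,
      pair (comp (v t)) w = pair v₀ w + ∫ s in (0 : ℝ)..t, vt s w) ∧
    (∀ᵐ t ∂(volume.restrict (Icc 0 T)), ∀ w : V Ω,
      vt t w + conv (v t) (v t) w + visc Ω ν τ (k t) (v t) w = pair (f t) w)
  k_ac : AbsolutelyContinuousOnInterval k 0 T
  k_init : k 0 = k₀
  k_eq : ∀ᵐ t ∂(volume.restrict (Icc 0 T)),
    HasDerivAt k (dissip Ω τ (k t) (v t) - √2 / 2 * τ⁻¹ * k t) t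

end HalfEq

end

noncomputable section

namespace HalfEq

open Filter Topology
open scoped RealInnerProductSpace ENNReal NNReal

variable {d : ℕ} {Ω : Set (Space d)}


/-! Put u = v₁ - v₂, κ = k₁ - k₂ and S(v, w) = ∫ μ ∇ˢv : ∇ˢw, and test the difference of the
momentum equations with u. Since ((v₂·∇)u, u) = 0, convection leaves only ((u·∇)v₁, u)
(`conv_sub_conv`). By Korn's identity (`symForm_id_self`) the viscous term gives ν‖∇u‖². The eddy
viscosity gives τ(κ S(v₁, u) + k₂ S(u, u)), whose last part is nonnegative because k₂ ≥ 0
(`IsStrongSolution.nonneg`). Thus extra regularity is needed of v₁ only.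

In dimensions two and three ‖u‖₄⁴ ≤ C‖u‖‖∇u‖³ (`exists_embedding_four`), so convection is at most a
constant times ‖u‖^(1/2) ‖∇u‖^(3/2) ‖∇v₁‖. Young's inequality turns this into a small multiple of
‖∇u‖² plus a multiple of ‖∇v₁‖⁴‖u‖²; hence the exponent 4.

The equation for κ contributes terms of order ‖∇u‖² with a coefficient that is bounded but not
small. They are absorbed by weighting: for α large, the viscosity in the balance for α‖u‖² + κ²
dominates them (`weighted_energy_le`). What remains is at most a multiple of (1 + ‖∇v₁‖⁴)(α‖u‖² +
κ²), and Grönwall's inequality with this integrable kernel gives zero.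

The time derivative lies only in L²(0,T;V'), so the balance for ‖u‖² rests on the Lions–Magenes
identity (`energy_identity`), obtained by regularizing with resolvents of the operator that
represents the L² product on V. -/

/-! ### Absolute continuity and Grönwall's inequality -/

theorem absolutelyContinuousOnInterval_of_dist_le {X Y : Type*} [PseudoMetricSpace X]
    [PseudoMetricSpace Y] {f : ℝ → X} {g : ℝ → Y} {a b C : ℝ}
    (hg : AbsolutelyContinuousOnInterval g a b)
    (h : ∀ s ∈ uIcc a b, ∀ t ∈ uIcc a b, dist (f s) (f t) ≤ C * dist (g s) (g t)) :
    AbsolutelyContinuousOnInterval f a b := by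
  have h2 := Tendsto.const_mul C hg
  rw [mul_zero] at h2
  refine squeeze_zero' (Eventually.of_forall fun E => Finset.sum_nonneg fun _ _ => dist_nonneg)
    ?_ h2
  filter_upwards [mem_inf_of_right (mem_principal_self _)] with E hE
  rw [Finset.mul_sum]
  exact Finset.sum_le_sum fun i hi => h _ (hE.1 i hi).1 _ (hE.1 i hi).2

theorem intervalIntegrable_of_integrable_Icc {E : Type*} [NormedAddCommGroup E] {T t : ℝ}
    {g : ℝ → E} (hg : Integrable g (volume.restrict (Icc 0 T))) (ht : t ∈ Icc 0 T) :
    IntervalIntegrable g volume 0 t := by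
  rw [intervalIntegrable_iff_integrableOn_Icc_of_le ht.1]
  exact IntegrableOn.mono_set hg (Icc_subset_Icc_right ht.2)

theorem absolutelyContinuousOnInterval_primitive {T : ℝ} {g : ℝ → ℝ} (hT : 0 ≤ T)
    (hg : Integrable g (volume.restrict (Icc 0 T))) :
    AbsolutelyContinuousOnInterval (fun t => ∫ s in (0 : ℝ)..t, g s) 0 T :=
  (intervalIntegrable_of_integrable_Icc hg ⟨hT, le_rfl⟩).absolutelyContinuousOnInterval_intervalIntegral
    (by simp)

/-- Grönwall's inequality for absolutely continuous functions and an integrable kernel. -/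
theorem nonpos_of_ae_deriv_le_mul {T : ℝ} (hT : 0 ≤ T) {y y' g : ℝ → ℝ}
    (hy : AbsolutelyContinuousOnInterval y 0 T) (hy0 : y 0 ≤ 0)
    (hg : Integrable g (volume.restrict (Icc 0 T)))
    (hd : ∀ᵐ t ∂(volume.restrict (Icc 0 T)), HasDerivAt y (y' t) t)
    (h : ∀ᵐ t ∂(volume.restrict (Icc 0 T)), y' t ≤ g t * y t) :
    ∀ t ∈ Icc 0 T, y t ≤ 0 := by
  intro t ht
  have hgi := intervalIntegrable_of_integrable_Icc hg ⟨hT, le_rfl⟩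
  set Γ : ℝ → ℝ := fun t => ∫ s in (0 : ℝ)..t, g s with hΓ
  have hΓac : AbsolutelyContinuousOnInterval Γ 0 T := absolutelyContinuousOnInterval_primitive hT hg
  have hΓd : ∀ᵐ t ∂(volume.restrict (Icc 0 T)), HasDerivAt Γ (g t) t := by
    rw [ae_restrict_iff' measurableSet_Icc]
    filter_upwards [hgi.ae_hasDerivAt_integral] with x hx hx'
    exact hx (by rwa [uIcc_of_le hT]) 0 (by simp)
  obtain ⟨K, hK⟩ : ∃ K : ℝ, ∀ t ∈ uIcc 0 T, |Γ t| ≤ K := hΓac.exists_bound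
  -- The exponential is Lipschitz on (-∞, K], where -Γ takes its values.
  have hexp : AbsolutelyContinuousOnInterval (fun t => Real.exp (-Γ t)) 0 T := by
    refine absolutelyContinuousOnInterval_of_dist_le (C := Real.exp K) hΓac fun s hs t ht => ?_
    have := Convex.norm_image_sub_le_of_norm_deriv_le (f := Real.exp) (s := Iic K)
      (C := Real.exp K) (fun x _ => Real.differentiableAt_exp)
      (fun x hx => by simpa [abs_of_pos (Real.exp_pos x)] using hx) (convex_Iic K)
      (x := -Γ s) (y := -Γ t) (by have := abs_le.1 (hK s hs); simp; linarith)
      (by have := abs_le.1 (hK t ht); simp; linarith)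
    rw [dist_comm, dist_eq_norm, Real.dist_eq]
    refine this.trans_eq ?_
    rw [Real.norm_eq_abs]; congr 2; ring
  -- Integrating factor: z' = (y' - g y) exp(-Γ) ≤ 0 almost everywhere, and absolute continuity
  -- makes z the integral of z'. No sign of g is needed.
  set z : ℝ → ℝ := fun t => y t * Real.exp (-Γ t) with hz
  have hzac : AbsolutelyContinuousOnInterval z 0 T := hy.fun_mul hexp
  have hzac' : AbsolutelyContinuousOnInterval z 0 t :=
    hzac.mono (by rw [uIcc_of_le hT, uIcc_of_le ht.1]; exact Icc_subset_Icc_right ht.2)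
  have hzd : ∀ᵐ t ∂(volume.restrict (Icc 0 T)), deriv z t ≤ 0 := by
    filter_upwards [hd, hΓd, h] with s h1 h2 h3
    have : HasDerivAt z (y' s * Real.exp (-Γ s) + y s * (Real.exp (-Γ s) * -g s)) s :=
      h1.mul h2.neg.exp
    rw [this.deriv]
    nlinarith [Real.exp_pos (-Γ s)]
  have h1 := hzac'.integral_deriv_eq_sub
  have h2 : ∫ s in (0 : ℝ)..t, deriv z s ≤ 0 := by
    rw [intervalIntegral.integral_of_le ht.1]
    refine integral_nonpos_of_ae (ae_restrict_of_ae_restrict_of_subset ?_ hzd)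
    exact Ioc_subset_Icc_self.trans (Icc_subset_Icc_right ht.2)
  have h3 : z 0 ≤ 0 := mul_nonpos_of_nonpos_of_nonneg hy0 (Real.exp_pos _).le
  have h4 : z t ≤ 0 := by linarith
  by_contra hcon
  exact absurd h4 (not_le.2 (mul_pos (not_le.1 hcon) (Real.exp_pos _)))

/-! ### The energy identity in a Hilbert space -/

section Hilbert

variable {X : Type*} [NormedAddCommGroup X] [InnerProductSpace ℝ X] [CompleteSpace X]

/-- The resolvents `(J + ε)⁻¹` of a positive symmetric operator. -/
theorem exists_resolvent {J : X →L[ℝ] X} (hsym : ∀ x y, ⟪J x, y⟫ = ⟪x, J y⟫)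
    (hpos : ∀ x, 0 ≤ ⟪J x, x⟫) {ε : ℝ} (hε : 0 < ε) :
    ∃ R : X →L[ℝ] X, (∀ x, J (R x) + ε • R x = x) ∧ (∀ x, R (J x) + ε • R x = x) ∧
      ∀ x y, ⟪R x, y⟫ = ⟪x, R y⟫ := by
  set S : X →L[ℝ] X := J + ε • ContinuousLinearMap.id ℝ X with hS
  have hSx : ∀ x, S x = J x + ε • x := fun x => by simp [hS]
  set B : X →L[ℝ] X →L[ℝ] ℝ := (innerSL ℝ).comp S with hB
  have hBx : ∀ x y, B x y = ⟪S x, y⟫ := fun x y => by simp [hB]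
  -- Positivity of `J` makes `B` coercive with constant ε, so Lax–Milgram inverts J + ε.
  have hc : IsCoercive B := ⟨ε, hε, fun u => by
    rw [hBx, hSx, inner_add_left, real_inner_smul_left, real_inner_self_eq_norm_mul_norm]
    nlinarith [hpos u]⟩
  set e := hc.continuousLinearEquivOfBilin with he
  have hex : ∀ x, e x = S x := fun x => by
    refine ext_inner_right ℝ fun w => ?_
    rw [he, hc.continuousLinearEquivOfBilin_apply, hBx]
  have hSs : ∀ x y, ⟪S x, y⟫ = ⟪x, S y⟫ := fun x y => by
    rw [hSx, hSx, inner_add_left, inner_add_right, hsym, real_inner_smul_left,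
      real_inner_smul_right]
  refine ⟨e.symm, fun x => ?_, fun x => ?_, fun x y => ?_⟩
  · have := hex (e.symm x)
    rw [e.apply_symm_apply, hSx] at this
    exact this.symm
  · have : e.symm (S x) = x := by rw [← hex, e.symm_apply_apply]
    rw [hSx, map_add, map_smul] at this
    exact this
  · obtain ⟨a, rfl⟩ := e.surjective x
    obtain ⟨b, rfl⟩ := e.surjective y
    simp only [ContinuousLinearEquiv.coe_coe, e.symm_apply_apply]
    rw [hex, hex, hSs]

/-- With R = (J + ε)⁻¹ and ε = 1/(n+1), the operators R J = 1 - εR are contractions. On the range of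
`J` they tend to the identity, as the error at J z is ε‖R J z‖ ≤ ε‖z‖. The range is dense because
`J` is symmetric and injective, and the uniform bound extends the convergence to all of X. -/
theorem exists_approx_inverse {J : X →L[ℝ] X} (hsym : ∀ x y, ⟪J x, y⟫ = ⟪x, J y⟫)
    (hpos : ∀ x, 0 ≤ ⟪J x, x⟫) (hinj : ∀ x, J x = 0 → x = 0) :
    ∃ R : ℕ → X →L[ℝ] X, (∀ n x y, ⟪R n x, y⟫ = ⟪x, R n y⟫) ∧
      (∀ n x, ‖R n (J x)‖ ≤ ‖x‖) ∧ ∀ x, Tendsto (fun n => R n (J x)) atTop (𝓝 x) := by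
  choose R hR1 hR2 hR3 using fun n : ℕ =>
    exists_resolvent hsym hpos (ε := 1 / ((n : ℝ) + 1)) (by positivity)
  have hb : ∀ n x, ‖R n (J x)‖ ≤ ‖x‖ := by
    intro n x
    set ε : ℝ := 1 / ((n : ℝ) + 1)
    have hε : 0 < ε := by positivity
    have e1 : R n (J x) = x - ε • R n x := eq_sub_of_add_eq (hR2 n x)
    have e2 : J (R n x) = R n (J x) := by
      rw [e1]; exact eq_sub_of_add_eq (hR1 n x)
    -- Since J commutes with R, pairing x = R J x + εR x with R J x gives ‖R J x‖² plus ε⟪J R x, R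
    -- x⟫ ≥ 0.
    have h0 := hpos (R n x)
    rw [e2] at h0
    have h1 : ⟪R n (J x), x⟫ = ⟪R n (J x), R n (J x)⟫ + ε * ⟪R n (J x), R n x⟫ := by
      rw [← real_inner_smul_right, ← inner_add_right, hR2]
    rw [real_inner_self_eq_norm_mul_norm] at h1
    have h2 := real_inner_le_norm (R n (J x)) x
    have h3 : ‖R n (J x)‖ * ‖R n (J x)‖ ≤ ‖R n (J x)‖ * ‖x‖ := by nlinarith
    by_contra hcon
    push Not at hcon
    nlinarith [norm_nonneg x]
  refine ⟨R, hR3, hb, fun x => ?_⟩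
  have hdense : Dense (J.range : Set X) := by
    rw [Submodule.dense_iff_topologicalClosure_eq_top, Submodule.topologicalClosure_eq_top_iff,
      Submodule.eq_bot_iff]
    intro y hy
    apply hinj
    have : ∀ z, ⟪J z, y⟫ = 0 := fun z => hy (J z) ⟨z, rfl⟩
    have h2 := this (J y)
    rw [hsym] at h2
    exact inner_self_eq_zero.1 h2
  rw [Metric.tendsto_atTop]
  intro δ hδ
  obtain ⟨_, ⟨z, rfl⟩, hz⟩ := hdense.exists_dist_lt x (ε := δ / 4) (by positivity)
  obtain ⟨N, hN⟩ := exists_nat_gt (‖z‖ / (δ / 4))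
  refine ⟨N, fun n hn => ?_⟩
  have hn' : ‖z‖ / (δ / 4) < (n : ℝ) + 1 := by
    have : (N : ℝ) ≤ n := by exact_mod_cast hn
    linarith
  have k1 : R n (J (J z)) - J z = -((1 / ((n : ℝ) + 1)) • R n (J z)) := by
    have := hR2 n (J z)
    rw [sub_eq_iff_eq_add, ← sub_eq_neg_add]
    exact eq_sub_of_add_eq this
  have k2 : ‖R n (J (J z)) - J z‖ ≤ δ / 4 := by
    rw [k1, norm_neg, norm_smul, Real.norm_of_nonneg (by positivity)]
    rw [div_lt_iff₀ (by positivity)] at hn'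
    rw [div_mul_eq_mul_div, one_mul, div_le_iff₀ (by positivity)]
    linarith [hb n z]
  have k3 : R n (J x) - x = R n (J (x - J z)) + (R n (J (J z)) - J z) - (x - J z) := by
    simp only [map_sub]; abel
  have hz' : ‖x - J z‖ < δ / 4 := by rwa [← dist_eq_norm]
  rw [dist_eq_norm, k3]
  calc _ ≤ ‖R n (J (x - J z))‖ + ‖R n (J (J z)) - J z‖ + ‖x - J z‖ :=
        (norm_sub_le _ _).trans (by gcongr; exact norm_add_le _ _)
    _ < δ := by linarith [hb n (x - J z)]

/-- The energy of a primitive with respect to a symmetric operator. -/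
theorem inner_integral_self {R : X →L[ℝ] X} (hR : ∀ x y, ⟪R x, y⟫ = ⟪x, R y⟫) {T : ℝ}
    {g : ℝ → X} (hg : Integrable g (volume.restrict (Icc 0 T))) {t : ℝ} (ht : t ∈ Icc 0 T) :
    ⟪R (∫ s in (0 : ℝ)..t, g s), ∫ s in (0 : ℝ)..t, g s⟫ =
      2 * ∫ s in (0 : ℝ)..t, ⟪R (∫ r in (0 : ℝ)..s, g r), g s⟫ := by
  have hgt : Integrable g (volume.restrict (Icc 0 t)) :=
    IntegrableOn.mono_set hg (Icc_subset_Icc_right ht.2)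
  have hgi := intervalIntegrable_of_integrable_Icc hg ht
  set F : ℝ → X := fun t => ∫ s in (0 : ℝ)..t, g s with hF
  -- The increments of the vector-valued F are dominated by those of the scalar primitive Γ, from
  -- which ψ then inherits absolute continuity.
  set Γ : ℝ → ℝ := fun t => ∫ s in (0 : ℝ)..t, ‖g s‖ with hΓ
  have hΓac : AbsolutelyContinuousOnInterval Γ 0 t := absolutelyContinuousOnInterval_primitive ht.1 hgt.norm
  have hdist : ∀ a ∈ uIcc 0 t, ∀ b ∈ uIcc 0 t, dist (F a) (F b) ≤ dist (Γ a) (Γ b) := by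
    intro a ha b hb
    have ia := hgi.mono_set (uIcc_subset_uIcc (by simp : (0 : ℝ) ∈ uIcc 0 t) ha)
    have ib := hgi.mono_set (uIcc_subset_uIcc (by simp : (0 : ℝ) ∈ uIcc 0 t) hb)
    rw [dist_eq_norm, Real.dist_eq, hF, hΓ]
    simp only
    rw [intervalIntegral.integral_interval_sub_left ia ib,
      intervalIntegral.integral_interval_sub_left ia.norm ib.norm]
    exact intervalIntegral.norm_integral_le_abs_integral_norm
  have hFb : ∀ a ∈ uIcc 0 t, ‖F a‖ ≤ Γ t := by
    intro a ha
    rw [uIcc_of_le ht.1] at ha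
    refine (intervalIntegral.norm_integral_le_integral_norm ha.1).trans ?_
    exact intervalIntegral.integral_mono_interval le_rfl ha.1 ha.2
      (Eventually.of_forall fun _ => norm_nonneg _) hgi.norm
  set ψ : ℝ → ℝ := fun t => ⟪R (F t), F t⟫ with hψ
  have hψac : AbsolutelyContinuousOnInterval ψ 0 t := by
    refine absolutelyContinuousOnInterval_of_dist_le (C := 2 * (‖R‖ * Γ t)) hΓac fun a ha b hb => ?_
    have e : ψ a - ψ b = ⟪R (F a), F a - F b⟫ + ⟪R (F b), F a - F b⟫ := by
      simp only [hψ, inner_sub_right, hR (F b) (F a), real_inner_comm (R (F a)) (F b)]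
      ring
    have hx : ∀ c ∈ uIcc 0 t, |⟪R (F c), F a - F b⟫| ≤ ‖R‖ * Γ t * dist (Γ a) (Γ b) := by
      intro c hc
      refine (abs_real_inner_le_norm _ _).trans ?_
      rw [← dist_eq_norm]
      have := hFb c hc
      exact mul_le_mul ((R.le_opNorm _).trans (by gcongr)) (hdist a ha b hb) dist_nonneg
        (mul_nonneg (norm_nonneg _) ((norm_nonneg _).trans this))
    rw [Real.dist_eq, e]
    exact (abs_add_le _ _).trans (by linarith [hx a ha, hx b hb])
  have h1 := hψac.integral_deriv_eq_sub
  have h0 : ψ 0 = 0 := by simp [hψ, hF]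
  rw [h0, sub_zero] at h1
  change ψ t = _
  rw [← h1, ← intervalIntegral.integral_const_mul]
  refine intervalIntegral.integral_congr_ae ?_
  filter_upwards [hgi.ae_hasDerivAt_integral] with s hs hs'
  have hd : HasDerivAt F (g s) s := hs (uIoc_subset_uIcc hs') 0 (by simp)
  have hd2 : HasDerivAt (fun s => R (F s)) (R (g s)) s := R.hasFDerivAt.comp_hasDerivAt s hd
  have hd3 : HasDerivAt ψ (⟪R (F s), g s⟫ + ⟪R (g s), F s⟫) s := hd2.inner ℝ hd
  rw [hd3.deriv, hR (g s), real_inner_comm]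
  ring

/-- The energy identity of Lions and Magenes: if `J u` is a primitive of `g`, then
`t ↦ ⟪J u, u⟫` is a primitive of `2 ⟪g, u⟫`. -/
theorem energy_identity {J : X →L[ℝ] X} (hsym : ∀ x y, ⟪J x, y⟫ = ⟪x, J y⟫)
    (hpos : ∀ x, 0 ≤ ⟪J x, x⟫) (hinj : ∀ x, J x = 0 → x = 0) {T : ℝ} {u g : ℝ → X}
    (hu : MemLp u 2 (volume.restrict (Icc 0 T))) (hg : MemLp g 2 (volume.restrict (Icc 0 T)))
    (h : ∀ᵐ t ∂(volume.restrict (Icc 0 T)), J (u t) = ∫ s in (0 : ℝ)..t, g s) :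
    ∀ᵐ t ∂(volume.restrict (Icc 0 T)), ⟪J (u t), u t⟫ = 2 * ∫ s in (0 : ℝ)..t, ⟪g s, u s⟫ := by
  obtain ⟨R, hRs, hRb, hRt⟩ := exists_approx_inverse hsym hpos hinj
  have hgi : Integrable g (volume.restrict (Icc 0 T)) := hg.integrable (by norm_num)
  have hbound : Integrable (fun s => ‖u s‖ * ‖g s‖) (volume.restrict (Icc 0 T)) :=
    hu.norm.integrable_mul hg.norm
  filter_upwards [h, ae_restrict_mem measurableSet_Icc] with t ht htT
  have hsub : Ioc 0 t ⊆ Icc 0 T := Ioc_subset_Icc_self.trans (Icc_subset_Icc_right htT.2)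
  -- `R n` stands in for the possibly unbounded inverse of `J`: for fixed n this is the chain rule
  -- for the primitive J u, and R n (J u) → u recovers the claim.
  have key : ∀ n, ⟪R n (J (u t)), J (u t)⟫ =
      2 * ∫ s in (0 : ℝ)..t, ⟪R n (J (u s)), g s⟫ := by
    intro n
    rw [ht, inner_integral_self (hRs n) hgi htT]
    congr 1
    rw [intervalIntegral.integral_of_le htT.1, intervalIntegral.integral_of_le htT.1]
    refine integral_congr_ae (ae_restrict_of_ae_restrict_of_subset hsub ?_)
    filter_upwards [h] with s hs
    rw [hs]
  have lim1 : Tendsto (fun n => ⟪R n (J (u t)), J (u t)⟫) atTop (𝓝 ⟪u t, J (u t)⟫) :=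
    (hRt (u t)).inner tendsto_const_nhds
  have lim2 : Tendsto (fun n => 2 * ∫ s in (0 : ℝ)..t, ⟪R n (J (u s)), g s⟫) atTop
      (𝓝 (2 * ∫ s in (0 : ℝ)..t, ⟪u s, g s⟫)) := by
    refine Tendsto.const_mul _ ?_
    simp only [intervalIntegral.integral_of_le htT.1]
    have hrest := Measure.restrict_mono hsub (le_refl (volume : Measure ℝ))
    -- The contraction bound on R n J makes ‖u‖‖g‖ a majorant for every n.
    refine tendsto_integral_of_dominated_convergence (fun s => ‖u s‖ * ‖g s‖) (fun n => ?_)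
      (hbound.mono_measure hrest) (fun n => Eventually.of_forall fun s => ?_)
      (Eventually.of_forall fun s => (hRt (u s)).inner tendsto_const_nhds)
    · exact (((R n).comp J).continuous.comp_aestronglyMeasurable
        (hu.1.mono_measure hrest)).inner (hg.1.mono_measure hrest)
    · rw [Real.norm_eq_abs]
      exact (abs_real_inner_le_norm _ _).trans (by gcongr; exact hRb n (u s))
  simp only [key] at lim1
  rw [hsym, tendsto_nhds_unique lim1 lim2]
  simp only [real_inner_comm]

end Hilbert

/-! ### Calculus of test functions -/

section Test

variable {φ ψ : Space d → ℝ}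

theorem IsTest.differentiable (h : IsTest Ω φ) : Differentiable ℝ φ :=
  h.1.differentiable (by simp)

theorem IsTest.zero : IsTest Ω (0 : Space d → ℝ) :=
  ⟨contDiff_const, HasCompactSupport.zero, by simp [tsupport]⟩

theorem IsTest.add (h : IsTest Ω φ) (h' : IsTest Ω ψ) : IsTest Ω (φ + ψ) :=
  ⟨h.1.add h'.1, h.2.1.add h'.2.1, (tsupport_add φ ψ).trans (union_subset h.2.2 h'.2.2)⟩

theorem IsTest.const_smul (h : IsTest Ω φ) (c : ℝ) : IsTest Ω (c • φ) :=
  ⟨h.1.const_smul c, h.2.1.smul_left (f := fun _ => c),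
    (tsupport_smul_subset_right (fun _ => c) φ).trans h.2.2⟩

theorem IsTest.mul (h : IsTest Ω φ) (h' : IsTest Ω ψ) : IsTest Ω (φ * ψ) :=
  ⟨h.1.mul h'.1, h.2.1.mul_right, (tsupport_mul_subset_left).trans h.2.2⟩

theorem IsTest.pderiv (h : IsTest Ω φ) (j : Fin d) : IsTest Ω (pderiv φ j) :=
  ⟨(h.1.fderiv_right (m := ∞) (by simp)).clm_apply contDiff_const, h.2.1.fderiv_apply ℝ _,
    (tsupport_fderiv_apply_subset ℝ _).trans h.2.2⟩

theorem IsTest.memLp (h : IsTest Ω φ) (p : ENNReal) : MemLp φ p (volume.restrict Ω) :=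
  (h.1.continuous.memLp_of_hasCompactSupport h.2.1).restrict Ω

theorem IsTest.eq_zero (h : IsTest Ω φ) {x : Space d} (hx : x ∉ Ω) : φ x = 0 :=
  image_eq_zero_of_notMem_tsupport fun hx' => hx (h.2.2 hx')

theorem pderiv_add (h : Differentiable ℝ φ) (h' : Differentiable ℝ ψ) (j : Fin d) :
    pderiv (φ + ψ) j = pderiv φ j + pderiv ψ j := by
  ext x
  simp only [pderiv, fderiv_add (h x) (h' x), Pi.add_apply, add_apply]

theorem pderiv_const_smul (h : Differentiable ℝ φ) (c : ℝ) (j : Fin d) :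
    pderiv (c • φ) j = c • pderiv φ j := by
  ext x
  simp only [pderiv, fderiv_const_smul (h x) c, Pi.smul_apply, smul_apply]

theorem pderiv_mul (h : Differentiable ℝ φ) (h' : Differentiable ℝ ψ) (j : Fin d) (x : Space d) :
    pderiv (φ * ψ) j x = φ x * pderiv ψ j x + ψ x * pderiv φ j x := by
  simp only [pderiv, fderiv_mul (h x) (h' x), add_apply,
    smul_apply, smul_eq_mul]

theorem pderiv_zero (j : Fin d) : pderiv (0 : Space d → ℝ) j = 0 := by
  ext x
  simp [pderiv]

theorem IsTest.pderiv_comm (h : IsTest Ω φ) (i j : Fin d) :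
    HalfEq.pderiv (HalfEq.pderiv φ i) j = HalfEq.pderiv (HalfEq.pderiv φ j) i := by
  ext x
  have hd : DifferentiableAt ℝ (fderiv ℝ φ) x :=
    ((h.1.fderiv_right (m := 1) (by norm_cast)).differentiable (by simp)) x
  have hsym : IsSymmSndFDerivAt ℝ φ x :=
    h.1.contDiffAt.isSymmSndFDerivAt (by simp only [minSmoothness_of_isRCLikeNormedField]; norm_cast)
  have hu : ∀ k, HalfEq.pderiv φ k = fun y => fderiv ℝ φ y (EuclideanSpace.single k 1) :=
    fun _ => rfl
  rw [HalfEq.pderiv, HalfEq.pderiv, hu, hu]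
  rw [fderiv_clm_apply hd (differentiableAt_const _), fderiv_clm_apply hd (differentiableAt_const _)]
  simpa using hsym.eq _ _

theorem setIntegral_test_mul (h : IsTest Ω φ) (g : Space d → ℝ) :
    ∫ x in Ω, φ x * g x = ∫ x, φ x * g x :=
  setIntegral_eq_integral_of_forall_compl_eq_zero fun x hx => by rw [h.eq_zero hx, zero_mul]

/-- Integration by parts for test functions. -/
theorem setIntegral_pderiv_mul (h : IsTest Ω φ) (h' : IsTest Ω ψ) (j : Fin d) :
    ∫ x in Ω, pderiv φ j x * ψ x = -∫ x in Ω, φ x * pderiv ψ j x := by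
  rw [setIntegral_test_mul (h.pderiv j), setIntegral_test_mul h]
  have hint : ∀ {f g : Space d → ℝ}, IsTest Ω f → IsTest Ω g →
      Integrable (fun x => f x * g x) := fun hf hg =>
    (hf.mul hg).1.continuous.integrable_of_hasCompactSupport (hf.mul hg).2.1
  have := integral_mul_fderiv_eq_neg_fderiv_mul_of_integrable (μ := volume) (f := φ) (g := ψ)
    (v := EuclideanSpace.single j (1 : ℝ)) (hint (h.pderiv j) h') (hint h (h'.pderiv j))
    (hint h h') (fun x _ => h.differentiable x) (fun x _ => h'.differentiable x)
  simp only [pderiv]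
  rw [this, neg_neg]

/-- A test function as an element of `L²(Ω)`. -/
def testL2 (h : IsTest Ω φ) : L2 Ω := (h.memLp 2).toLp φ

theorem coeFn_testL2 (h : IsTest Ω φ) : testL2 h =ᵐ[volume.restrict Ω] φ := MemLp.coeFn_toLp _

theorem inner_eq_integral (f g : L2 Ω) : ⟪f, g⟫ = ∫ x in Ω, f x * g x := by
  rw [L2.inner_def]
  exact integral_congr_ae (Eventually.of_forall fun x => by simp [mul_comm])

theorem inner_testL2_right (f : L2 Ω) (h : IsTest Ω φ) :
    ⟪f, testL2 h⟫ = ∫ x in Ω, f x * φ x := by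
  rw [inner_eq_integral]
  refine integral_congr_ae ?_
  filter_upwards [coeFn_testL2 h] with x hx
  rw [hx]

theorem inner_testL2_testL2 (h : IsTest Ω φ) (h' : IsTest Ω ψ) :
    ⟪testL2 h, testL2 h'⟫ = ∫ x in Ω, φ x * ψ x := by
  rw [inner_testL2_right]
  refine integral_congr_ae ?_
  filter_upwards [coeFn_testL2 h] with x hx
  rw [hx]

/-- A test function with its gradient as an element of `H₀¹(Ω)`. -/
def testPair (h : IsTest Ω φ) : L2 Ω × (Fin d → L2 Ω) := (testL2 h, fun j => testL2 (h.pderiv j))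

theorem mem_testGraph_iff {p : L2 Ω × (Fin d → L2 Ω)} :
    p ∈ testGraph Ω ↔ ∃ (φ : Space d → ℝ) (h : IsTest Ω φ), p = testPair h := by
  constructor
  · rintro ⟨φ, h, h1, h2⟩
    refine ⟨φ, h, Prod.ext (Lp.ext (h1.trans (coeFn_testL2 h).symm)) (funext fun j => ?_)⟩
    exact Lp.ext ((h2 j).trans (coeFn_testL2 (h.pderiv j)).symm)
  · rintro ⟨φ, h, rfl⟩
    exact ⟨φ, h, coeFn_testL2 h, fun j => coeFn_testL2 (h.pderiv j)⟩

end Test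

/-! ### Weak gradients in H₀¹(Ω) -/

section Sobolev

/-- Test functions already form a subspace, so `H10` is a plain closure and closed conditions need
checking on test functions only. -/
theorem span_testGraph : (Submodule.span ℝ (testGraph Ω) : Set _) = testGraph Ω := by
  refine Subset.antisymm (fun p hp => ?_) Submodule.subset_span
  refine Submodule.span_induction (p := fun p _ => p ∈ testGraph Ω) (fun _ h => h) ?_ ?_ ?_ hp
  · refine ⟨0, IsTest.zero, Lp.coeFn_zero _ _ _, fun j => ?_⟩
    rw [pderiv_zero]
    exact Lp.coeFn_zero _ _ _
  · rintro p q - - ⟨φ, h, h1, h2⟩ ⟨ψ, h', h1', h2'⟩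
    refine ⟨φ + ψ, h.add h', (Lp.coeFn_add _ _).trans (h1.add h1'), fun j => ?_⟩
    rw [pderiv_add h.differentiable h'.differentiable]
    exact (Lp.coeFn_add _ _).trans ((h2 j).add (h2' j))
  · rintro c p - ⟨φ, h, h1, h2⟩
    refine ⟨c • φ, h.const_smul c, (Lp.coeFn_smul _ _).trans (h1.const_smul c), fun j => ?_⟩
    rw [pderiv_const_smul h.differentiable]
    exact (Lp.coeFn_smul _ _).trans ((h2 j).const_smul c)

theorem coe_H10 : (H10 Ω : Set (L2 Ω × (Fin d → L2 Ω))) = closure (testGraph Ω) := by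
  rw [H10, Submodule.topologicalClosure_coe, span_testGraph]

theorem testPair_mem_H10 {φ : Space d → ℝ} (h : IsTest Ω φ) : testPair h ∈ H10 Ω := by
  rw [← SetLike.mem_coe, coe_H10]
  exact subset_closure (mem_testGraph_iff.2 ⟨φ, h, rfl⟩)

/-- A closed property of the test functions holds on all of `H₀¹(Ω)`. -/
theorem H10_induction {P : L2 Ω × (Fin d → L2 Ω) → Prop} (hc : IsClosed {p | P p})
    (ht : ∀ (φ : Space d → ℝ) (h : IsTest Ω φ), P (testPair h)) {p : L2 Ω × (Fin d → L2 Ω)}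
    (hp : p ∈ H10 Ω) : P p := by
  rw [← SetLike.mem_coe, coe_H10] at hp
  refine closure_minimal (fun q hq => ?_) hc hp
  obtain ⟨φ, h, rfl⟩ := mem_testGraph_iff.1 hq
  exact ht φ h

/-- A closed property of the test functions holds on all of `H₀¹(Ω)`. -/
theorem H10_induction' {P : H10 Ω → Prop} (hc : IsClosed {p | P p})
    (ht : ∀ (φ : Space d → ℝ) (h : IsTest Ω φ), P ⟨testPair h, testPair_mem_H10 h⟩)
    (p : H10 Ω) : P p := by
  have hp := p.2
  rw [← SetLike.mem_coe, coe_H10] at hp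
  have : p ∈ closure (Subtype.val ⁻¹' testGraph Ω : Set (H10 Ω)) := by
    rw [closure_subtype]
    refine closure_mono (fun q hq => ?_) hp
    obtain ⟨φ, h, rfl⟩ := mem_testGraph_iff.1 hq
    exact ⟨⟨testPair h, testPair_mem_H10 h⟩, hq, rfl⟩
  refine closure_minimal (fun q hq => ?_) hc this
  obtain ⟨φ, h, hq⟩ := mem_testGraph_iff.1 hq
  rw [show q = ⟨testPair h, testPair_mem_H10 h⟩ from Subtype.ext hq]
  exact ht φ h

/-- Integration by parts survives the closure because both sides are continuous in `p`; hence `p.2`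
is the weak gradient of `p.1`. -/
theorem inner_grad_test {p : L2 Ω × (Fin d → L2 Ω)} (hp : p ∈ H10 Ω) {ψ : Space d → ℝ}
    (h : IsTest Ω ψ) (j : Fin d) : ⟪p.2 j, testL2 h⟫ = -⟪p.1, testL2 (h.pderiv j)⟫ := by
  refine H10_induction (P := fun p => ⟪p.2 j, testL2 h⟫ = -⟪p.1, testL2 (h.pderiv j)⟫)
    (isClosed_eq (by fun_prop) (by fun_prop)) (fun φ h' => ?_) hp
  simp only [testPair, inner_testL2_testL2]
  exact setIntegral_pderiv_mul h' h j

/-- The gradient is closable on test functions. -/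
theorem grad_eq_zero (hΩ : IsOpen Ω) {p : L2 Ω × (Fin d → L2 Ω)} (hp : p ∈ H10 Ω)
    (h0 : p.1 = 0) : p.2 = 0 := by
  funext j
  have hLI : LocallyIntegrableOn (p.2 j) Ω volume := by
    have : MemLp (p.2 j) 2 (volume.restrict Ω) := Lp.memLp _
    have h1 := (this.locallyIntegrable (by norm_num))
    intro x hx
    obtain ⟨K, hK, hKi⟩ := h1 x
    obtain ⟨U, hU, hxU, hUK⟩ : ∃ U, U ⊆ K ∧ IsOpen U ∧ x ∈ U := mem_nhds_iff.1 hK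
    refine ⟨U ∩ Ω, mem_nhdsWithin_of_mem_nhds (hxU.inter hΩ |>.mem_nhds ⟨hUK, hx⟩), ?_⟩
    have h2 : IntegrableOn (p.2 j) U (volume.restrict Ω) := hKi.mono_set hU
    rwa [IntegrableOn, Measure.restrict_restrict hxU.measurableSet] at h2
  -- A weak derivative of zero integrates to zero against every test function.
  have := hΩ.ae_eq_zero_of_integral_contDiff_smul_eq_zero hLI fun g hg1 hg2 hg3 => by
    have ht : IsTest Ω g := ⟨hg1, hg2, hg3⟩
    have h1 := inner_grad_test hp ht j
    rw [h0, inner_zero_left, neg_zero, inner_testL2_right] at h1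
    simp_rw [smul_eq_mul]
    rw [← setIntegral_test_mul ht, ← h1]
    simp_rw [mul_comm]
  refine Lp.ext ?_
  rw [Pi.zero_apply]
  refine EventuallyEq.trans ?_ (Lp.coeFn_zero _ _ _).symm
  rw [EventuallyEq, ae_restrict_iff' hΩ.measurableSet]
  exact this

/-- For q a test function φ, both sides are -⟪p, ∂ᵢ∂ⱼφ⟫ by the weak derivative of p, and second
derivatives commute. This is the source of Korn's identity. -/
theorem inner_grad_comm {p q : L2 Ω × (Fin d → L2 Ω)} (hp : p ∈ H10 Ω) (hq : q ∈ H10 Ω)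
    (i j : Fin d) : ⟪p.2 i, q.2 j⟫ = ⟪p.2 j, q.2 i⟫ := by
  refine H10_induction (P := fun q => ⟪p.2 i, q.2 j⟫ = ⟪p.2 j, q.2 i⟫)
    (isClosed_eq (by fun_prop) (by fun_prop)) (fun φ h => ?_) hq
  simp only [testPair, inner_grad_test hp]
  congr 2
  simp only [h.pderiv_comm i j]

end Sobolev

/-! ### Sobolev and Ladyzhenskaya inequalities; the trilinear cancellation -/

section Embedding

theorem norm_fderiv_le_sum (φ : Space d → ℝ) (x : Space d) :
    ‖fderiv ℝ φ x‖ ≤ ∑ j, ‖pderiv φ j x‖ := by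
  refine ContinuousLinearMap.opNorm_le_bound _ (Finset.sum_nonneg fun _ _ => norm_nonneg _)
    fun y => ?_
  have hy : y = ∑ j, y j • EuclideanSpace.single j (1 : ℝ) := by
    ext i
    simp [Finset.sum_apply, Pi.single_apply]
  conv_lhs => rw [hy]
  rw [map_sum, Finset.sum_mul]
  refine (norm_sum_le _ _).trans (Finset.sum_le_sum fun j _ => ?_)
  rw [map_smul, norm_smul, mul_comm]
  exact mul_le_mul_of_nonneg_left (PiLp.norm_apply_le y j) (norm_nonneg _)

theorem eLpNorm_fderiv_le {φ : Space d → ℝ} (h : IsTest Ω φ) :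
    eLpNorm (fderiv ℝ φ) 2 (volume.restrict Ω) ≤ d * ‖(testPair h).2‖ₑ := by
  have h1 : eLpNorm (fderiv ℝ φ) 2 (volume.restrict Ω) ≤
      eLpNorm (∑ j, fun x => ‖pderiv φ j x‖) 2 (volume.restrict Ω) := by
    refine eLpNorm_mono_real fun x => ?_
    rw [Finset.sum_apply]
    exact norm_fderiv_le_sum φ x
  refine h1.trans ((eLpNorm_sum_le (fun j _ => ?_) (by norm_num)).trans ?_)
  · exact (h.pderiv j).1.continuous.norm.aestronglyMeasurable
  · have : ∀ j ∈ Finset.univ, eLpNorm (fun x => ‖pderiv φ j x‖) 2 (volume.restrict Ω) ≤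
        ‖(testPair h).2‖ₑ := by
      intro j _
      rw [eLpNorm_norm, ← eLpNorm_congr_ae (coeFn_testL2 (h.pderiv j)), ← Lp.enorm_def]
      rw [← ofReal_norm, ← ofReal_norm]
      exact ENNReal.ofReal_le_ofReal (norm_le_pi_norm (testPair h).2 j)
    refine (Finset.sum_le_sum this).trans ?_
    simp

/-- The exponent solves 1/r - 1/d = 1/6: r = 3/2 in the plane and r = 2 in space. The requirement r
< d excludes r = 2 in the plane. -/
theorem exists_gns (hd : d = 2 ∨ d = 3) (hΩb : Bornology.IsBounded Ω) :
    ∃ C r : ℝ≥0, 1 ≤ r ∧ r ≤ 2 ∧ ∀ φ : Space d → ℝ, IsTest Ω φ →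
      eLpNorm φ 6 volume ≤ C * eLpNorm (fderiv ℝ φ) r volume := by
  obtain ⟨q, hq⟩ : ∃ q : ℝ≥0, q = 6 := ⟨6, rfl⟩
  have hq' : (6 : ℝ≥0∞) = q := by rw [hq, ENNReal.coe_ofNat]
  obtain ⟨r, hr1, hr2, hrd, hr6⟩ : ∃ r : ℝ≥0, 1 ≤ r ∧ r ≤ 2 ∧ (r : ℝ) < d ∧
      ((r⁻¹ : ℝ≥0) : ℝ) - (d : ℝ)⁻¹ ≤ (q : ℝ)⁻¹ := by
    rw [hq]
    rcases hd with h | h <;> rw [h]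
    · refine ⟨3 / 2, ?_, ?_, by norm_num, by norm_num⟩
      · rw [← NNReal.coe_le_coe]; norm_num
      · rw [← NNReal.coe_le_coe]; norm_num
    · exact ⟨2, by norm_num, le_rfl, by norm_num, by norm_num⟩
  have hfr : Module.finrank ℝ (Space d) = d := by simp
  refine ⟨eLpNormLESNormFDerivOfLeConst ℝ (volume : Measure (Space d)) Ω r q, r, hr1, hr2,
    fun φ h => ?_⟩
  rw [hq']
  exact eLpNorm_le_eLpNorm_fderiv_of_le (μ := volume) (p := r) (q := q)
    (h.1.of_le (by norm_cast)) ((subset_tsupport φ).trans h.2.2) hr1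
    (by rw [hfr]; exact_mod_cast hrd) (by rw [hfr]; exact hr6) hΩb

theorem exists_sobolev_test (hd : d = 2 ∨ d = 3) (hΩb : Bornology.IsBounded Ω) :
    ∃ C : ℝ≥0, ∀ (φ : Space d → ℝ) (h : IsTest Ω φ),
      eLpNorm φ 6 (volume.restrict Ω) ≤ C * ‖(testPair h).2‖ₑ := by
  obtain ⟨C₁, r, hr1, hr2, hC₁⟩ := exists_gns hd hΩb
  -- Hölder constant |Ω|^(1/r - 1/2) for passing from L^r to L² on the bounded set Ω.
  obtain ⟨m, hm⟩ : ∃ m : ℝ≥0,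
      (m : ℝ≥0∞) = volume Ω ^ (1 / (r : ℝ≥0∞).toReal - 1 / (2 : ℝ≥0∞).toReal) := by
    refine ⟨_, ENNReal.coe_toNNReal (ENNReal.rpow_ne_top_of_nonneg ?_ hΩb.measure_lt_top.ne)⟩
    rw [ENNReal.coe_toReal, ENNReal.toReal_ofNat, sub_nonneg]
    exact one_div_le_one_div_of_le (by exact_mod_cast zero_lt_one.trans_le hr1)
      (by exact_mod_cast hr2)
  refine ⟨C₁ * (m * d), fun φ h => ?_⟩
  have hs : Function.support φ ⊆ Ω := (subset_tsupport φ).trans h.2.2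
  have hs' : Function.support (fun x => ‖fderiv ℝ φ x‖) ⊆ Ω := fun x hx =>
    h.2.2 (tsupport_fderiv_subset ℝ (subset_tsupport _ fun h0 => hx (by simp [h0])))
  have h1 := hC₁ φ h
  have h2 : eLpNorm (fderiv ℝ φ) r (volume.restrict Ω) ≤
      eLpNorm (fderiv ℝ φ) 2 (volume.restrict Ω) * m := by
    have := eLpNorm_le_eLpNorm_mul_rpow_measure_univ (μ := volume.restrict Ω) (f := fderiv ℝ φ)
      (p := r) (q := 2) (by exact_mod_cast hr2)
      (h.1.continuous_fderiv (by simp)).aestronglyMeasurable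
    rwa [Measure.restrict_apply_univ, ← hm] at this
  have h3 : eLpNorm (fderiv ℝ φ) r (volume.restrict Ω) = eLpNorm (fderiv ℝ φ) r volume := by
    rw [← eLpNorm_norm (fderiv ℝ φ), ← eLpNorm_norm (fderiv ℝ φ)]
    exact eLpNorm_restrict_eq_of_support_subset hs'
  rw [eLpNorm_restrict_eq_of_support_subset hs]
  rw [← h3] at h1
  calc _ ≤ (C₁ : ℝ≥0∞) * eLpNorm (fderiv ℝ φ) r (volume.restrict Ω) := h1
    _ ≤ C₁ * ((d * ‖(testPair h).2‖ₑ) * m) := by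
        gcongr
        exact h2.trans (by gcongr; exact eLpNorm_fderiv_le h)
    _ = _ := by
        push_cast
        ring

/-- The Sobolev inequality `‖u‖_{L⁶} ≤ C ‖∇u‖_{L²}` on `H₀¹(Ω)` in dimensions two and three. -/
theorem exists_sobolev (hd : d = 2 ∨ d = 3) (hΩb : Bornology.IsBounded Ω) :
    ∃ C : ℝ≥0, ∀ p ∈ H10 Ω, eLpNorm p.1 6 (volume.restrict Ω) ≤ C * ‖p.2‖ₑ := by
  obtain ⟨C, hC⟩ := exists_sobolev_test hd hΩb
  refine ⟨C, fun p hp => H10_induction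
    (P := fun p => eLpNorm p.1 6 (volume.restrict Ω) ≤ C * ‖p.2‖ₑ) ?_ (fun φ h => ?_) hp⟩
  -- The L⁶ norm is only lower semicontinuous under L² convergence: pass to an almost everywhere
  -- convergent subsequence and use Fatou.
  · refine IsSeqClosed.isClosed fun q p hq hqp => ?_
    have h1 : Tendsto (fun n => (q n).1) atTop (𝓝 p.1) := (continuous_fst.tendsto p).comp hqp
    have h2 : Tendsto (fun n => (q n).2) atTop (𝓝 p.2) := (continuous_snd.tendsto p).comp hqp
    obtain ⟨ns, hns, hae⟩ := (tendstoInMeasure_of_tendsto_Lp h1).exists_seq_tendsto_ae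
    refine (Lp.eLpNorm_lim_le_liminf_eLpNorm (f := fun i => (q (ns i)).1)
      (fun i => Lp.aestronglyMeasurable _) _ hae).trans ?_
    have h3 : Tendsto (fun i => (C : ℝ≥0∞) * ‖(q (ns i)).2‖ₑ) atTop (𝓝 (C * ‖p.2‖ₑ)) :=
      ENNReal.Tendsto.const_mul ((continuous_enorm.tendsto _).comp (h2.comp hns.tendsto_atTop))
        (Or.inr ENNReal.coe_ne_top)
    rw [← h3.liminf_eq]
    exact liminf_le_liminf (Eventually.of_forall fun i => hq (ns i))
  · rw [show eLpNorm (testPair h).1 6 (volume.restrict Ω) = eLpNorm φ 6 (volume.restrict Ω) from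
      eLpNorm_congr_ae (coeFn_testL2 h)]
    exact hC φ h

/-- Cauchy–Schwarz for |f|⁴ = |f| · |f|³. -/
theorem eLpNorm_four_le {α : Type*} [MeasurableSpace α] {μ : Measure α} {f : α → ℝ}
    (hf : AEStronglyMeasurable f μ) :
    eLpNorm f 4 μ ^ 4 ≤ eLpNorm f 2 μ * eLpNorm f 6 μ ^ 3 := by
  have e : ∀ n : ℕ, n ≠ 0 → eLpNorm f (n : ℝ≥0∞) μ = (∫⁻ x, ‖f x‖ₑ ^ n ∂μ) ^ (1 / (n : ℝ)) := by
    intro n hn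
    rw [eLpNorm_eq_lintegral_rpow_enorm_toReal (by exact_mod_cast hn) (ENNReal.natCast_ne_top n)]
    simp
  have e4 := e 4 (by norm_num)
  have e2 := e 2 (by norm_num)
  have e6 := e 6 (by norm_num)
  norm_num at e4 e2 e6
  rw [e4, e2, e6, ← ENNReal.rpow_mul_natCast, ← ENNReal.rpow_mul_natCast]
  have := ENNReal.lintegral_mul_le_Lp_mul_Lq μ (p := 2) (q := 2)
    (Real.holderConjugate_iff.2 ⟨by norm_num, by norm_num⟩) (f := fun x => ‖f x‖ₑ)
    (g := fun x => ‖f x‖ₑ ^ 3) hf.enorm (hf.enorm.pow_const 3)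
  norm_num
  simp only [Pi.mul_apply, ← pow_succ', ENNReal.rpow_ofNat, ← pow_mul] at this
  norm_num at this
  exact this

instance fact_one_le_four : Fact ((1 : ℝ≥0∞) ≤ 4) := ⟨by norm_num⟩

instance holderTriple_four_four_two : ENNReal.HolderTriple 4 4 2 := ⟨by
  rw [← two_mul, show (4 : ℝ≥0∞) = 2 * 2 by norm_num, ENNReal.mul_inv (by simp) (by simp),
    ← mul_assoc, ENNReal.mul_inv_cancel (by simp) (by simp), one_mul]⟩

/-- The embedding `H₀¹(Ω) ⊆ L⁴(Ω)` with Ladyzhenskaya's inequality. -/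
theorem exists_embedding_four (hd : d = 2 ∨ d = 3) (hΩb : Bornology.IsBounded Ω) :
    ∃ (C : ℝ) (E : H10 Ω →L[ℝ] Lp ℝ 4 (volume.restrict Ω)), 0 ≤ C ∧
      (∀ p, E p =ᵐ[volume.restrict Ω] p.1.1) ∧
      ∀ p, ‖E p‖ ^ 4 ≤ C * ‖p.1.1‖ * ‖p.1.2‖ ^ 3 := by
  obtain ⟨C, hC⟩ := exists_sobolev hd hΩb
  have hb : ∀ p : H10 Ω, eLpNorm p.1.1 4 (volume.restrict Ω) ^ 4 ≤
      ‖p.1.1‖ₑ * (C * ‖p.1.2‖ₑ) ^ 3 := fun p =>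
    (eLpNorm_four_le (Lp.aestronglyMeasurable _)).trans
      (by rw [Lp.enorm_def]; gcongr; exact hC _ p.2)
  have hmem : ∀ p : H10 Ω, MemLp p.1.1 4 (volume.restrict Ω) := fun p => by
    refine ⟨Lp.aestronglyMeasurable _, ?_⟩
    have h1 : eLpNorm p.1.1 4 (volume.restrict Ω) ^ 4 < ⊤ :=
      (hb p).trans_lt (ENNReal.mul_lt_top enorm_lt_top
        (ENNReal.pow_lt_top (ENNReal.mul_lt_top ENNReal.coe_lt_top enorm_lt_top)))
    by_contra hcon
    rw [not_lt_top_iff] at hcon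
    rw [hcon] at h1
    simp at h1
  let E₀ : H10 Ω →ₗ[ℝ] Lp ℝ 4 (volume.restrict Ω) :=
    { toFun := fun p => (hmem p).toLp
      map_add' := fun p q => by
        rw [← MemLp.toLp_add]
        exact MemLp.toLp_congr _ _ (Lp.coeFn_add _ _)
      map_smul' := fun c p => by
        rw [RingHom.id_apply, ← MemLp.toLp_const_smul]
        exact MemLp.toLp_congr _ _ (Lp.coeFn_smul _ _) }
  have hE : ∀ p, ‖E₀ p‖ ^ 4 ≤ (C : ℝ) ^ 3 * ‖p.1.1‖ * ‖p.1.2‖ ^ 3 := fun p => by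
    have h1 : ‖E₀ p‖ = (eLpNorm p.1.1 4 (volume.restrict Ω)).toReal :=
      Lp.norm_toLp _ (hmem p)
    rw [h1, ← ENNReal.toReal_pow]
    have h2 := ENNReal.toReal_mono (ENNReal.mul_ne_top enorm_ne_top
      (ENNReal.pow_ne_top (ENNReal.mul_ne_top ENNReal.coe_ne_top enorm_ne_top))) (hb p)
    refine h2.trans_eq ?_
    simp only [ENNReal.toReal_mul, ENNReal.toReal_pow, toReal_enorm, ENNReal.coe_toReal]
    ring
  -- The available bound is on fourth powers; as max 1 C³ is at least 1, it is below its own fourth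
  -- power and no root has to be taken.
  refine ⟨(C : ℝ) ^ 3, E₀.mkContinuous (max 1 ((C : ℝ) ^ 3)) fun p => ?_, by positivity,
    fun p => MemLp.coeFn_toLp (hmem p), fun p => hE p⟩
  refine le_of_pow_le_pow_left₀ (n := 4) (by norm_num) (by positivity) ((hE p).trans ?_)
  have h1 : ‖p.1.1‖ ≤ ‖p‖ := norm_fst_le p.1
  have h2 : ‖p.1.2‖ ≤ ‖p‖ := norm_snd_le p.1
  calc (C : ℝ) ^ 3 * ‖p.1.1‖ * ‖p.1.2‖ ^ 3 ≤ max 1 ((C : ℝ) ^ 3) * ‖p‖ * ‖p‖ ^ 3 := by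
        gcongr
        exact le_max_right _ _
    _ = max 1 ((C : ℝ) ^ 3) * ‖p‖ ^ 4 := by ring
    _ ≤ max 1 ((C : ℝ) ^ 3) ^ 4 * ‖p‖ ^ 4 := by
        gcongr
        exact le_self_pow₀ (le_max_left _ _) (by norm_num)
    _ = _ := by ring

/-- The product `L⁴ × L⁴ → L²`. -/
def mulFour (Ω : Set (Space d)) :
    Lp ℝ 4 (volume.restrict Ω) →L[ℝ] Lp ℝ 4 (volume.restrict Ω) →L[ℝ] L2 Ω :=
  (ContinuousLinearMap.mul ℝ ℝ).holderL (volume.restrict Ω) 4 4 2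

theorem coeFn_mulFour (f g : Lp ℝ 4 (volume.restrict Ω)) :
    mulFour Ω f g =ᵐ[volume.restrict Ω] fun x => f x * g x :=
  (ContinuousLinearMap.mul ℝ ℝ).coeFn_holder f g

theorem norm_mulFour_le (f g : Lp ℝ 4 (volume.restrict Ω)) :
    ‖mulFour Ω f g‖ ≤ ‖f‖ * ‖g‖ := by
  have := (ContinuousLinearMap.mul ℝ ℝ).norm_holder_apply_apply_le (r := 2) f g
  rwa [ContinuousLinearMap.opNorm_mul, one_mul] at this

theorem inner_mulFour (f g : Lp ℝ 4 (volume.restrict Ω)) (h : L2 Ω) :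
    ⟪mulFour Ω f g, h⟫ = ∫ x in Ω, f x * g x * h x := by
  rw [inner_eq_integral]
  refine integral_congr_ae ?_
  filter_upwards [coeFn_mulFour f g] with x hx
  rw [hx]

/-- `∫ φ v · ∇φ = 0` for a divergence-free field `v`. -/
theorem sum_inner_mulFour_eq_zero {E : H10 Ω →L[ℝ] Lp ℝ 4 (volume.restrict Ω)}
    (hE : ∀ p, E p =ᵐ[volume.restrict Ω] p.1.1) (v : Fin d → H10 Ω)
    (hv : ∑ j, (v j).1.2 j = 0) (p : H10 Ω) :
    ∑ j, ⟪mulFour Ω (E (v j)) (E p), p.1.2 j⟫ = 0 := by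
  refine H10_induction' (P := fun p => ∑ j, ⟪mulFour Ω (E (v j)) (E p), p.1.2 j⟫ = 0)
    (isClosed_eq (by fun_prop) continuous_const) (fun φ h => ?_) p
  -- φ∇φ = ∇(φ²/2) and φ²/2 is again a test function, so the derivative moves onto v and produces
  -- its divergence.
  have h2 : IsTest Ω ((1 / 2 : ℝ) • (φ * φ)) := (h.mul h).const_smul _
  have hpd : ∀ j x, pderiv ((1 / 2 : ℝ) • (φ * φ)) j x = φ x * pderiv φ j x := by
    intro j x
    rw [pderiv_const_smul (h.mul h).differentiable, Pi.smul_apply,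
      pderiv_mul h.differentiable h.differentiable, smul_eq_mul]
    ring
  have key : ∀ j, ⟪mulFour Ω (E (v j)) (E ⟨testPair h, testPair_mem_H10 h⟩), testL2 (h.pderiv j)⟫ =
      -⟪(v j).1.2 j, testL2 h2⟫ := by
    intro j
    rw [inner_grad_test (v j).2, neg_neg, inner_mulFour, inner_testL2_right]
    refine integral_congr_ae ?_
    filter_upwards [hE (v j), hE ⟨testPair h, testPair_mem_H10 h⟩, coeFn_testL2 h,
      coeFn_testL2 (h.pderiv j)] with x h1 h2 h3 h4
    rw [h1, h2, h4, hpd]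
    simp only [testPair]
    rw [h3]
    ring
  simp only [testPair] at key ⊢
  rw [Finset.sum_congr rfl fun j _ => key j, Finset.sum_neg_distrib, ← sum_inner, hv,
    inner_zero_left, neg_zero]

end Embedding

/-! ### The viscous and convective forms on V -/

section Forms

theorem comp_sub (u v : V Ω) (i : Fin d) : comp (u - v) i = comp u i - comp v i := rfl

theorem dcomp_sub (u v : V Ω) (i j : Fin d) : dcomp (u - v) i j = dcomp u i j - dcomp v i j := rfl

theorem continuous_comp (i : Fin d) : Continuous fun u : V Ω => comp u i :=
  (continuous_apply i).comp (continuous_fst.comp continuous_subtype_val)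

theorem continuous_dcomp (i j : Fin d) : Continuous fun u : V Ω => dcomp u i j :=
  (continuous_apply j).comp ((continuous_apply i).comp
    (continuous_snd.comp continuous_subtype_val))

/-- The component `u_i` of `u ∈ V` with its gradient. -/
def compPair (u : V Ω) (i : Fin d) : H10 Ω := ⟨(comp u i, dcomp u i), u.2.1 i⟩

theorem compPair_sub (u v : V Ω) (i : Fin d) :
    compPair (u - v) i = compPair u i - compPair v i := rfl

theorem sum_dcomp_self (u : V Ω) : ∑ i, dcomp u i i = 0 := u.2.2

theorem norm_sq_eq_integral (f : L2 Ω) : ‖f‖ ^ 2 = ∫ x in Ω, f x ^ 2 := by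
  rw [← real_inner_self_eq_norm_sq, inner_eq_integral]
  simp only [pow_two]

theorem gradNorm_sq (u : V Ω) : gradNorm u ^ 2 = ∑ i, ∑ j, ‖dcomp u i j‖ ^ 2 := by
  rw [gradNorm, Real.sq_sqrt]
  · simp only [norm_sq_eq_integral]
  · exact Finset.sum_nonneg fun i _ => Finset.sum_nonneg fun j _ =>
      integral_nonneg fun x => sq_nonneg _

theorem gradNorm_nonneg (u : V Ω) : 0 ≤ gradNorm u := Real.sqrt_nonneg _

theorem norm_dcomp_le (u : V Ω) (i j : Fin d) : ‖dcomp u i j‖ ≤ gradNorm u := by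
  refine le_of_sq_le_sq ?_ (gradNorm_nonneg u)
  rw [gradNorm_sq]
  exact (Finset.single_le_sum (f := fun j => ‖dcomp u i j‖ ^ 2) (fun _ _ => by positivity)
    (Finset.mem_univ j)).trans (Finset.single_le_sum
      (f := fun i => ∑ j, ‖dcomp u i j‖ ^ 2) (fun _ _ => by positivity) (Finset.mem_univ i))

/-- The kinetic energy `‖u‖²`. -/
def energy (u : V Ω) : ℝ := ∑ i, ‖comp u i‖ ^ 2

theorem energy_nonneg (u : V Ω) : 0 ≤ energy u := Finset.sum_nonneg fun _ _ => by positivity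

theorem norm_comp_le (u : V Ω) (i : Fin d) : ‖comp u i‖ ≤ √(energy u) := by
  refine Real.le_sqrt_of_sq_le ?_
  exact Finset.single_le_sum (f := fun i => ‖comp u i‖ ^ 2) (fun _ _ => by positivity)
    (Finset.mem_univ i)

theorem pair_eq_inner (g : Fin d → L2 Ω) (w : V Ω) : pair g w = ∑ i, ⟪g i, comp w i⟫ := by
  simp only [pair, inner_eq_integral]

/-- The symmetric gradient as a matrix of elements of `L²(Ω)`. -/
def symL2 (u : V Ω) (i j : Fin d) : L2 Ω := (1 / 2 : ℝ) • (dcomp u i j + dcomp u j i)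

theorem symL2_sub (u v : V Ω) (i j : Fin d) : symL2 (u - v) i j = symL2 u i j - symL2 v i j := by
  simp only [symL2, dcomp_sub, ← smul_sub]
  congr 1
  abel

theorem coeFn_symL2 (u : V Ω) (i j : Fin d) :
    symL2 u i j =ᵐ[volume.restrict Ω] symGrad u i j := by
  filter_upwards [Lp.coeFn_smul (1 / 2 : ℝ) (dcomp u i j + dcomp u j i),
    Lp.coeFn_add (dcomp u i j) (dcomp u j i)] with x h1 h2
  rw [symL2, h1, Pi.smul_apply, h2, Pi.add_apply, symGrad, smul_eq_mul]
  ring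

theorem continuous_symL2 (i j : Fin d) : Continuous fun u : V Ω => symL2 u i j :=
  Continuous.const_smul (g := fun u : V Ω => dcomp u i j + dcomp u j i)
    ((continuous_dcomp i j).add (continuous_dcomp j i)) (1 / 2 : ℝ)

theorem norm_symL2_le (u : V Ω) (i j : Fin d) : ‖symL2 u i j‖ ≤ gradNorm u := by
  rw [symL2, norm_smul]
  have := norm_add_le (dcomp u i j) (dcomp u j i)
  norm_num
  linarith [norm_dcomp_le u i j, norm_dcomp_le u j i]

/-- The form `∑ ∫ (A ∇ˢu) : ∇ˢw` for an operator `A` on `L²(Ω)`. -/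
def symForm (A : L2 Ω →L[ℝ] L2 Ω) (u w : V Ω) : ℝ := ∑ i, ∑ j, ⟪A (symL2 u i j), symL2 w i j⟫

theorem symForm_sub_left (A : L2 Ω →L[ℝ] L2 Ω) (u v w : V Ω) :
    symForm A (u - v) w = symForm A u w - symForm A v w := by
  simp only [symForm, symL2_sub, map_sub, inner_sub_left, Finset.sum_sub_distrib]

theorem symForm_sub_right (A : L2 Ω →L[ℝ] L2 Ω) (u v w : V Ω) :
    symForm A u (v - w) = symForm A u v - symForm A u w := by
  simp only [symForm, symL2_sub, inner_sub_right, Finset.sum_sub_distrib]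

theorem symForm_comm {A : L2 Ω →L[ℝ] L2 Ω} (hA : ∀ f g, ⟪A f, g⟫ = ⟪f, A g⟫) (u w : V Ω) :
    symForm A u w = symForm A w u := by
  refine Finset.sum_congr rfl fun i _ => Finset.sum_congr rfl fun j _ => ?_
  rw [hA, real_inner_comm]

theorem symForm_self_nonneg {A : L2 Ω →L[ℝ] L2 Ω} (hA : ∀ f, 0 ≤ ⟪A f, f⟫) (u : V Ω) :
    0 ≤ symForm A u u :=
  Finset.sum_nonneg fun _ _ => Finset.sum_nonneg fun _ _ => hA _

theorem continuous_symForm_self (A : L2 Ω →L[ℝ] L2 Ω) :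
    Continuous fun u : V Ω => symForm A u u :=
  continuous_finsetSum _ fun i _ => continuous_finsetSum _ fun j _ =>
    (A.continuous.comp (continuous_symL2 i j)).inner (continuous_symL2 i j)

theorem abs_symForm_le (A : L2 Ω →L[ℝ] L2 Ω) (u w : V Ω) :
    |symForm A u w| ≤ (d * d * ‖A‖) * gradNorm u * gradNorm w := by
  have h : ∀ i j, |⟪A (symL2 u i j), symL2 w i j⟫| ≤ ‖A‖ * gradNorm u * gradNorm w := fun i j =>
    (abs_real_inner_le_norm _ _).trans (mul_le_mul ((A.le_opNorm _).trans
      (mul_le_mul_of_nonneg_left (norm_symL2_le u i j) (norm_nonneg _))) (norm_symL2_le w i j)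
      (norm_nonneg _) (mul_nonneg (norm_nonneg _) (gradNorm_nonneg _)))
  refine (Finset.abs_sum_le_sum_abs _ _).trans ((Finset.sum_le_sum fun i _ =>
    (Finset.abs_sum_le_sum_abs _ _).trans (Finset.sum_le_sum fun j _ => h i j)).trans_eq ?_)
  simp only [Finset.sum_const, Finset.card_univ, Fintype.card_fin, nsmul_eq_mul]
  ring

/-- Korn's identity for divergence-free fields. -/
theorem symForm_id_self (u : V Ω) :
    symForm (ContinuousLinearMap.id ℝ _) u u = gradNorm u ^ 2 / 2 := by
  have h1 : ∀ i j, ⟪symL2 u i j, symL2 u i j⟫ =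
      1 / 4 * ‖dcomp u i j‖ ^ 2 + 1 / 4 * ‖dcomp u j i‖ ^ 2 +
        1 / 2 * ⟪dcomp u i i, dcomp u j j⟫ := by
    intro i j
    -- Exchanging the derivatives turns the cross terms into a sum equal to ‖∇·u‖² = 0.
    have h2 : ⟪dcomp u i j, dcomp u j i⟫ = ⟪dcomp u i i, dcomp u j j⟫ :=
      inner_grad_comm (compPair u i).2 (compPair u j).2 j i
    rw [symL2, real_inner_smul_left, real_inner_smul_right, real_inner_add_add_self,
      real_inner_self_eq_norm_sq, real_inner_self_eq_norm_sq, h2]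
    ring
  have h3 : ∑ i, ∑ j, ⟪dcomp u i i, dcomp u j j⟫ = 0 := by
    simp only [← inner_sum, sum_dcomp_self, inner_zero_right, Finset.sum_const_zero]
  have h4 : ∑ i, ∑ j, ‖dcomp u j i‖ ^ 2 = ∑ i, ∑ j, ‖dcomp u i j‖ ^ 2 := Finset.sum_comm
  simp only [symForm, ContinuousLinearMap.id_apply, h1, Finset.sum_add_distrib, ← Finset.mul_sum]
  rw [h3, h4, gradNorm_sq]
  ring

theorem integrable_L2_mul (f g : L2 Ω) : Integrable (fun x => f x * g x) (volume.restrict Ω) :=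
  (Lp.memLp f).integrable_mul (Lp.memLp g)

/-- Multiplication by the bounded function `μ` on `L²(Ω)`. -/
theorem exists_mul_mu (hΩo : IsOpen Ω) (hΩb : Bornology.IsBounded Ω) :
    ∃ A : L2 Ω →L[ℝ] L2 Ω, ∀ f, A f =ᵐ[volume.restrict Ω] fun x => mu Ω x * f x := by
  have hcont : Continuous (mu Ω) :=
    continuous_const.mul (((Metric.continuous_infDist_pt _).div_const _).pow 2)
  obtain ⟨K, hK⟩ := (hΩb.isCompact_closure).exists_bound_of_continuousOn hcont.continuousOn
  have hm : MemLp (mu Ω) ⊤ (volume.restrict Ω) :=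
    memLp_top_of_bound hcont.aestronglyMeasurable K <| by
      filter_upwards [ae_restrict_mem hΩo.measurableSet] with x hx
      exact hK x (subset_closure hx)
  refine ⟨(ContinuousLinearMap.mul ℝ ℝ).holderL (volume.restrict Ω) ⊤ 2 2 (hm.toLp (mu Ω)), fun f => ?_⟩
  have h1 : (ContinuousLinearMap.mul ℝ ℝ).holder 2 (hm.toLp (mu Ω)) f =ᵐ[volume.restrict Ω]
      fun x => hm.toLp (mu Ω) x * f x := (ContinuousLinearMap.mul ℝ ℝ).coeFn_holder _ f
  refine h1.trans ?_
  filter_upwards [hm.coeFn_toLp] with x hx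
  rw [hx]

theorem inner_mul_mu {A : L2 Ω →L[ℝ] L2 Ω}
    (hA : ∀ f, A f =ᵐ[volume.restrict Ω] fun x => mu Ω x * f x) (f g : L2 Ω) : ⟪A f, g⟫ = ∫ x in Ω, mu Ω x * f x * g x := by
  rw [inner_eq_integral]
  refine integral_congr_ae ?_
  filter_upwards [hA f] with x hx
  rw [hx]

theorem inner_mul_mu_comm {A : L2 Ω →L[ℝ] L2 Ω}
    (hA : ∀ f, A f =ᵐ[volume.restrict Ω] fun x => mu Ω x * f x) (f g : L2 Ω) : ⟪A f, g⟫ = ⟪f, A g⟫ := by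
  rw [real_inner_comm (A g), inner_mul_mu hA, inner_mul_mu hA]
  congr 1
  ext x
  ring

theorem inner_mul_mu_self_nonneg {A : L2 Ω →L[ℝ] L2 Ω}
    (hA : ∀ f, A f =ᵐ[volume.restrict Ω] fun x => mu Ω x * f x) (f : L2 Ω) : 0 ≤ ⟪A f, f⟫ := by
  rw [inner_mul_mu hA]
  refine integral_nonneg fun x => ?_
  have : 0 ≤ mu Ω x := mul_nonneg (by norm_num) (sq_nonneg _)
  show 0 ≤ mu Ω x * f x * f x
  rw [mul_assoc]
  exact mul_nonneg this (mul_self_nonneg _)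

/-- Serves both equations: (a, b) = (2ν, κτ) is the viscous term and (0, κτ) the source of the
k-equation. -/
theorem integral_sum_mul_symGrad {A : L2 Ω →L[ℝ] L2 Ω}
    (hA : ∀ f, A f =ᵐ[volume.restrict Ω] fun x => mu Ω x * f x) (a b : ℝ) (u w : V Ω) :
    ∫ x in Ω, (a + mu Ω x * b) * ∑ i, ∑ j, symGrad u i j x * symGrad w i j x =
      a * symForm (ContinuousLinearMap.id ℝ _) u w + b * symForm A u w := by
  have hint : ∀ i j, Integrable (fun x => a * (symL2 u i j x * symL2 w i j x) +
      b * ((A (symL2 u i j)) x * symL2 w i j x)) (volume.restrict Ω) := fun i j =>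
    ((integrable_L2_mul _ _).const_mul a).add ((integrable_L2_mul _ _).const_mul b)
  have h1 : (fun x => (a + mu Ω x * b) * ∑ i, ∑ j, symGrad u i j x * symGrad w i j x)
      =ᵐ[volume.restrict Ω] fun x => ∑ i, ∑ j, (a * (symL2 u i j x * symL2 w i j x) +
        b * ((A (symL2 u i j)) x * symL2 w i j x)) := by
    have e1 : ∀ᵐ x ∂(volume.restrict Ω), ∀ i j, symL2 u i j x = symGrad u i j x :=
      ae_all_iff.2 fun i => ae_all_iff.2 fun j => coeFn_symL2 u i j
    have e2 : ∀ᵐ x ∂(volume.restrict Ω), ∀ i j, symL2 w i j x = symGrad w i j x :=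
      ae_all_iff.2 fun i => ae_all_iff.2 fun j => coeFn_symL2 w i j
    have e3 : ∀ᵐ x ∂(volume.restrict Ω), ∀ i j,
        (A (symL2 u i j)) x = mu Ω x * symL2 u i j x :=
      ae_all_iff.2 fun i => ae_all_iff.2 fun j => hA _
    filter_upwards [e1, e2, e3] with x h1 h2 h3
    rw [Finset.mul_sum]
    refine Finset.sum_congr rfl fun i _ => ?_
    rw [Finset.mul_sum]
    refine Finset.sum_congr rfl fun j _ => ?_
    rw [h3, h1, h2]
    ring
  rw [integral_congr_ae h1, integral_finsetSum _ fun i _ => integrable_finsetSum _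
    fun j _ => hint i j]
  simp only [symForm, Finset.mul_sum, ← Finset.sum_add_distrib]
  refine Finset.sum_congr rfl fun i _ => ?_
  rw [integral_finsetSum _ fun j _ => hint i j]
  refine Finset.sum_congr rfl fun j _ => ?_
  rw [integral_add ((integrable_L2_mul _ _).const_mul a) ((integrable_L2_mul _ _).const_mul b),
    integral_const_mul, integral_const_mul, inner_eq_integral, inner_eq_integral]
  rfl

theorem visc_eq {A : L2 Ω →L[ℝ] L2 Ω}
    (hA : ∀ f, A f =ᵐ[volume.restrict Ω] fun x => mu Ω x * f x) (ν τ κ : ℝ) (u w : V Ω) : visc Ω ν τ κ u w =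
    2 * ν * symForm (ContinuousLinearMap.id ℝ _) u w + κ * τ * symForm A u w := by
  rw [← integral_sum_mul_symGrad hA]
  simp only [visc, mul_assoc]

theorem dissip_eq {A : L2 Ω →L[ℝ] L2 Ω}
    (hA : ∀ f, A f =ᵐ[volume.restrict Ω] fun x => mu Ω x * f x) (τ κ : ℝ) (v : V Ω) :
    dissip Ω τ κ v = 1 / volume.real Ω * (κ * τ * symForm A v v) := by
  have := integral_sum_mul_symGrad hA 0 (κ * τ) v v
  rw [zero_mul, zero_add] at this
  rw [← this]
  simp only [dissip, zero_add, mul_assoc, pow_two]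

/-- The convection term expressed by bounded multilinear maps. -/
def convForm (E : H10 Ω →L[ℝ] Lp ℝ 4 (volume.restrict Ω)) (u v w : V Ω) : ℝ :=
  ∑ i, ∑ j, ⟪mulFour Ω (E (compPair u j)) (E (compPair w i)), dcomp v i j⟫

theorem conv_eq {E : H10 Ω →L[ℝ] Lp ℝ 4 (volume.restrict Ω)}
    (hE : ∀ p, E p =ᵐ[volume.restrict Ω] p.1.1) (u v w : V Ω) : conv u v w = convForm E u v w := by
  have h1 : (fun x => ∑ i, ∑ j, comp u j x * dcomp v i j x * comp w i x) =ᵐ[volume.restrict Ω]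
      fun x => ∑ i, ∑ j, mulFour Ω (E (compPair u j)) (E (compPair w i)) x * dcomp v i j x := by
    have e1 : ∀ᵐ x ∂(volume.restrict Ω), ∀ i, E (compPair u i) x = comp u i x :=
      ae_all_iff.2 fun i => hE _
    have e2 : ∀ᵐ x ∂(volume.restrict Ω), ∀ i, E (compPair w i) x = comp w i x :=
      ae_all_iff.2 fun i => hE _
    have e3 : ∀ᵐ x ∂(volume.restrict Ω), ∀ i j,
        mulFour Ω (E (compPair u j)) (E (compPair w i)) x =
          E (compPair u j) x * E (compPair w i) x :=
      ae_all_iff.2 fun i => ae_all_iff.2 fun j => coeFn_mulFour _ _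
    filter_upwards [e1, e2, e3] with x h1 h2 h3
    refine Finset.sum_congr rfl fun i _ => Finset.sum_congr rfl fun j _ => ?_
    rw [h3, h1, h2]
    ring
  rw [conv, integral_congr_ae h1, integral_finsetSum _ fun i _ => integrable_finsetSum _
    fun j _ => integrable_L2_mul _ _, convForm]
  refine Finset.sum_congr rfl fun i _ => ?_
  rw [integral_finsetSum _ fun j _ => integrable_L2_mul _ _]
  simp only [inner_eq_integral]

theorem convForm_self_right {E : H10 Ω →L[ℝ] Lp ℝ 4 (volume.restrict Ω)}
    (hE : ∀ p, E p =ᵐ[volume.restrict Ω] p.1.1) (v u : V Ω) : convForm E v u u = 0 :=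
  Finset.sum_eq_zero fun i _ => sum_inner_mulFour_eq_zero hE (compPair v) (sum_dcomp_self v)
    (compPair u i)

/-- With u = v₁ - v₂, the difference is (u·∇)v₁ + (v₂·∇)u, and the second field is orthogonal to u.
No gradient of v₂ is left to estimate. -/
theorem conv_sub_conv {E : H10 Ω →L[ℝ] Lp ℝ 4 (volume.restrict Ω)}
    (hE : ∀ p, E p =ᵐ[volume.restrict Ω] p.1.1) (v₁ v₂ : V Ω) :
    conv v₁ v₁ (v₁ - v₂) - conv v₂ v₂ (v₁ - v₂) = conv (v₁ - v₂) v₁ (v₁ - v₂) := by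
  have h := convForm_self_right hE v₂ (v₁ - v₂)
  rw [conv_eq hE, conv_eq hE, conv_eq hE]
  have h1 : ∀ w, convForm E (v₁ - v₂) v₁ w = convForm E v₁ v₁ w - convForm E v₂ v₁ w := fun w => by
    simp only [convForm, compPair_sub v₁ v₂, map_sub, sub_apply, inner_sub_left,
      Finset.sum_sub_distrib]
  have h2 : ∀ w, convForm E v₂ (v₁ - v₂) w = convForm E v₂ v₁ w - convForm E v₂ v₂ w := fun w => by
    simp only [convForm, dcomp_sub, inner_sub_right, Finset.sum_sub_distrib]
  rw [h2] at h
  rw [h1]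
  linarith

/-- Hölder in L⁴ × L⁴ × L² for each of the d² terms, with Ladyzhenskaya's inequality for the two
factors u. The root times `gradNorm u` is √C ‖u‖^(1/2) ‖∇u‖^(3/2). -/
theorem abs_conv_le {E : H10 Ω →L[ℝ] Lp ℝ 4 (volume.restrict Ω)}
    (hE : ∀ p, E p =ᵐ[volume.restrict Ω] p.1.1) {C : ℝ} (hC : 0 ≤ C) (hEC : ∀ p, ‖E p‖ ^ 4 ≤ C * ‖p.1.1‖ * ‖p.1.2‖ ^ 3)
    (u v : V Ω) :
    |conv u v u| ≤ d * d * (√(C * √(energy u) * gradNorm u) * gradNorm u * gradNorm v) := by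
  set n := gradNorm u
  have hn : 0 ≤ n := gradNorm_nonneg u
  set r := √(C * √(energy u) * n)
  have hr : r ^ 2 = C * √(energy u) * n := Real.sq_sqrt (by positivity)
  have hb : ∀ i, ‖E (compPair u i)‖ ^ 2 ≤ r * n := fun i => by
    refine le_of_sq_le_sq ?_ (by positivity)
    rw [← pow_mul, mul_pow, hr]
    refine (hEC _).trans ?_
    have h1 : ‖(compPair u i).1.1‖ ≤ √(energy u) := norm_comp_le u i
    have h2 : ‖(compPair u i).1.2‖ ≤ n :=
      (pi_norm_le_iff_of_nonneg hn).2 fun j => norm_dcomp_le u i j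
    calc C * ‖(compPair u i).1.1‖ * ‖(compPair u i).1.2‖ ^ 3 ≤ C * √(energy u) * n ^ 3 := by
          gcongr
      _ = _ := by ring
  have h : ∀ i j, |⟪mulFour Ω (E (compPair u j)) (E (compPair u i)), dcomp v i j⟫| ≤
      r * n * gradNorm v := fun i j => by
    refine (abs_real_inner_le_norm _ _).trans (mul_le_mul ((norm_mulFour_le _ _).trans ?_)
      (norm_dcomp_le v i j) (norm_nonneg _) (by positivity))
    nlinarith [hb i, hb j, sq_nonneg (‖E (compPair u i)‖ - ‖E (compPair u j)‖)]
  rw [conv_eq hE]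
  refine (Finset.abs_sum_le_sum_abs _ _).trans ((Finset.sum_le_sum fun i _ =>
    (Finset.abs_sum_le_sum_abs _ _).trans (Finset.sum_le_sum fun j _ => h i j)).trans_eq ?_)
  simp only [Finset.sum_const, Finset.card_univ, Fintype.card_fin, nsmul_eq_mul]
  ring

end Forms

/-! ### The energy identity in V -/

section Energy

/-- The energy identity in a Banach space `B` that embeds as a closed subspace of a Hilbert space,
with the duality between `B` and its dual. -/
theorem energy_identity_of_embedding {B Y : Type*} [NormedAddCommGroup B] [NormedSpace ℝ B]
    [CompleteSpace B] [NormedAddCommGroup Y] [InnerProductSpace ℝ Y] [CompleteSpace Y]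
    {Φ : B →L[ℝ] Y} (hΦ : ∀ v, ‖v‖ ≤ ‖Φ v‖) {b : B →L[ℝ] B →L[ℝ] ℝ}
    (hsym : ∀ v w, b v w = b w v) (hpos : ∀ v, 0 ≤ b v v) (hinj : ∀ v, b v v = 0 → v = 0)
    {T : ℝ} {u : ℝ → B} {g : ℝ → StrongDual ℝ B}
    (hu : MemLp u 2 (volume.restrict (Icc 0 T))) (hg : MemLp g 2 (volume.restrict (Icc 0 T)))
    (h : ∀ᵐ t ∂(volume.restrict (Icc 0 T)), ∀ w, b (u t) w = ∫ s in (0 : ℝ)..t, g s w) :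
    ∀ᵐ t ∂(volume.restrict (Icc 0 T)), b (u t) (u t) = 2 * ∫ s in (0 : ℝ)..t, g s (u s) := by
  -- The lower bound makes the range of Φ closed, hence a Hilbert space isomorphic to `B`. The form
  -- and the functionals are carried there and represented by Riesz as `J` and `gX`.
  have hanti : AntilipschitzWith 1 Φ :=
    ContinuousLinearMap.antilipschitz_of_bound _ fun v => by simpa using hΦ v
  have hcl : IsClosed (Set.range Φ) := hanti.isClosed_range Φ.uniformContinuous
  have : CompleteSpace Φ.range := hcl.completeSpace_coe
  let e : B ≃L[ℝ] Φ.range := Φ.equivRange hanti.injective hcl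
  let es : Φ.range →L[ℝ] B := e.symm
  let bX : Φ.range →L[ℝ] Φ.range →L[ℝ] ℝ := b.bilinearComp es es
  have hbX : ∀ x y, bX x y = b (e.symm x) (e.symm y) := fun x y => rfl
  let J : Φ.range →L[ℝ] Φ.range := InnerProductSpace.continuousLinearMapOfBilin (𝕜 := ℝ) bX
  have hJ : ∀ x y, ⟪J x, y⟫ = b (e.symm x) (e.symm y) := fun x y =>
    InnerProductSpace.continuousLinearMapOfBilin_apply bX x y
  let gX : ℝ → Φ.range := fun s => (InnerProductSpace.toDual ℝ Φ.range).symm ((g s).comp es)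
  have hgX : ∀ s x, ⟪gX s, x⟫ = g s (e.symm x) := fun s x =>
    InnerProductSpace.toDual_symm_apply
  have huX : MemLp (fun t => e (u t)) 2 (volume.restrict (Icc 0 T)) :=
    (e : B →L[ℝ] Φ.range).comp_memLp' hu
  have hgm : MemLp gX 2 (volume.restrict (Icc 0 T)) := by
    have h1 : MemLp (fun s => (g s).comp es) 2 (volume.restrict (Icc 0 T)) :=
      ((ContinuousLinearMap.compL ℝ Φ.range B ℝ).flip es).comp_memLp' hg
    refine MemLp.of_le (F := StrongDual ℝ Φ.range) h1 ((InnerProductSpace.toDual ℝ Φ.range).symm.continuous.comp_aestronglyMeasurable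
      h1.1) (Eventually.of_forall fun s => ?_)
    exact ((InnerProductSpace.toDual ℝ Φ.range).symm.norm_map _).le
  have hgi : Integrable gX (volume.restrict (Icc 0 T)) := hgm.integrable (by norm_num)
  have key := energy_identity (J := J) (T := T) (u := fun t => e (u t)) (g := gX)
    (fun x y => by rw [hJ, real_inner_comm, hJ, hsym]) (fun x => by rw [hJ]; exact hpos _)
    (fun x hx => by
      have h1 : b (e.symm x) (e.symm x) = 0 := by rw [← hJ, hx, inner_zero_left]
      exact e.symm.map_eq_zero_iff.1 (hinj _ h1)) huX hgm (by
      filter_upwards [h, ae_restrict_mem measurableSet_Icc] with t ht htT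
      refine ext_inner_right ℝ fun x => ?_
      rw [hJ, e.symm_apply_apply, ht, real_inner_comm]
      have hi := intervalIntegrable_of_integrable_Icc hgi htT
      have := (innerSL ℝ x).intervalIntegral_comp_comm hi
      simp only [innerSL_apply_apply] at this
      rw [← this]
      refine intervalIntegral.integral_congr fun s _ => ?_
      rw [real_inner_comm, hgX])
  filter_upwards [key] with t ht
  simp only [hJ, hgX, e.symm_apply_apply] at ht
  exact ht

instance completeSpace_V : CompleteSpace (V Ω) := by
  have h1 : IsClosed (divFree Ω : Set (Pairs Ω)) := by
    have hH : IsClosed (H10 Ω : Set (L2 Ω × (Fin d → L2 Ω))) :=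
      Submodule.isClosed_topologicalClosure _
    have : (divFree Ω : Set (Pairs Ω)) =
        (⋂ i, (fun u : Pairs Ω => (u.1 i, u.2 i)) ⁻¹' (H10 Ω)) ∩
          {u | ∑ i, u.2 i i = 0} := by
      ext u
      simp only [mem_inter_iff, mem_iInter, mem_preimage]
      rfl
    rw [this]
    exact (isClosed_iInter fun i => hH.preimage (by fun_prop)).inter
      (isClosed_eq (by fun_prop) continuous_const)
  exact h1.completeSpace_coe

/-- The Hilbert space of the components and the derivatives of a field. -/
abbrev HilbertPairs (Ω : Set (Space d)) : Type :=
  PiLp 2 fun _ : Fin d ⊕ Fin d × Fin d => L2 Ω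

/-- The embedding of `V` into a Hilbert space. -/
def toHilbert (Ω : Set (Space d)) : V Ω →L[ℝ] HilbertPairs Ω where
  toFun u := WithLp.toLp 2 (Sum.elim (comp u) fun ij => dcomp u ij.1 ij.2)
  map_add' u v := by
    ext1 k
    rcases k with i | ij <;> rfl
  map_smul' c u := by
    ext1 k
    rcases k with i | ij <;> rfl
  cont := by
    refine (PiLp.continuous_toLp 2 _).comp (continuous_pi fun k => ?_)
    rcases k with i | ij
    · exact continuous_comp i
    · exact continuous_dcomp ij.1 ij.2

theorem norm_le_norm_toHilbert (u : V Ω) : ‖u‖ ≤ ‖toHilbert Ω u‖ := by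
  have h1 : ∀ i, ‖comp u i‖ ≤ ‖toHilbert Ω u‖ := fun i =>
    PiLp.norm_apply_le (toHilbert Ω u) (Sum.inl i)
  have h2 : ∀ i j, ‖dcomp u i j‖ ≤ ‖toHilbert Ω u‖ := fun i j =>
    PiLp.norm_apply_le (toHilbert Ω u) (Sum.inr (i, j))
  have h0 := norm_nonneg (toHilbert Ω u)
  exact max_le ((pi_norm_le_iff_of_nonneg h0).2 h1)
    ((pi_norm_le_iff_of_nonneg h0).2 fun i => (pi_norm_le_iff_of_nonneg h0).2 fun j => h2 i j)

/-- The component `u ↦ u_i` as a bounded linear map. -/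
def compL (Ω : Set (Space d)) (i : Fin d) : V Ω →L[ℝ] L2 Ω where
  toFun u := comp u i
  map_add' _ _ := rfl
  map_smul' _ _ := rfl
  cont := continuous_comp i

/-- The inner product of `L²(Ω)^d` as a form on `V`. -/
def pairForm (Ω : Set (Space d)) : V Ω →L[ℝ] V Ω →L[ℝ] ℝ :=
  ∑ i, (innerSL ℝ : L2 Ω →L[ℝ] L2 Ω →L[ℝ] ℝ).bilinearComp (compL Ω i) (compL Ω i)

theorem pairForm_apply (u w : V Ω) : pairForm Ω u w = pair (comp u) w := by
  simp only [pairForm, sum_apply, pair_eq_inner]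
  rfl

theorem pairForm_self (u : V Ω) : pairForm Ω u u = energy u := by
  rw [pairForm_apply, pair_eq_inner, energy]
  simp only [real_inner_self_eq_norm_sq]

/-- A field is a pair (u, ∇u) and the energy sees only u; closability of the gradient removes the
second component. -/
theorem eq_zero_of_energy_eq_zero (hΩo : IsOpen Ω) {u : V Ω} (h : energy u = 0) : u = 0 := by
  have h1 : ∀ i, comp u i = 0 := fun i => by
    have := (Finset.sum_eq_zero_iff_of_nonneg fun i _ => sq_nonneg ‖comp u i‖).1 h i
      (Finset.mem_univ i)
    simpa using this
  have h2 : ∀ i, dcomp u i = 0 := fun i => grad_eq_zero hΩo (compPair u i).2 (h1 i)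
  exact Subtype.ext (Prod.ext (funext h1) (funext fun i => h2 i))

theorem energy_eq_integral (hΩo : IsOpen Ω) {T : ℝ} {u : ℝ → V Ω} {g : ℝ → StrongDual ℝ (V Ω)}
    (hu : MemLp u 2 (volume.restrict (Icc 0 T))) (hg : MemLp g 2 (volume.restrict (Icc 0 T)))
    (h : ∀ᵐ t ∂(volume.restrict (Icc 0 T)), ∀ w,
      pair (comp (u t)) w = ∫ s in (0 : ℝ)..t, g s w) :
    ∀ᵐ t ∂(volume.restrict (Icc 0 T)), energy (u t) = 2 * ∫ s in (0 : ℝ)..t, g s (u s) := by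
  have := energy_identity_of_embedding (Φ := toHilbert Ω) (b := pairForm Ω) (T := T)
    norm_le_norm_toHilbert
    (fun v w => by simp only [pairForm_apply, pair_eq_inner, real_inner_comm])
    (fun v => by rw [pairForm_self]; exact energy_nonneg v)
    (fun v hv => eq_zero_of_energy_eq_zero hΩo (by rwa [pairForm_self] at hv)) hu hg
    (by simpa only [pairForm_apply] using h)
  simpa only [pairForm_self] using this

end Energy

/-! ### Young's inequality for the convection term -/

section Inequality

/-- Young with exponents 4/3 and 4, as two completed squares costing δ/2 · n² each: the first leaves
C h n, linear in n, and the second removes that n. -/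
theorem young_conv {C δ n a h : ℝ} (D : ℝ) (hC : 0 ≤ C) (hδ : 0 < δ) (hn : 0 ≤ n)
    (hh : 0 ≤ h) :
    D * (√(C * h * n) * n * a) ≤ δ * n ^ 2 + D ^ 4 * C ^ 2 / (8 * δ ^ 3) * (a ^ 4 * h ^ 2) := by
  set r := √(C * h * n)
  have hr : r ^ 2 = C * h * n := Real.sq_sqrt (by positivity)
  have h1 : D * (r * n * a) ≤ δ / 2 * n ^ 2 + D ^ 2 * a ^ 2 / (2 * δ) * (C * h * n) := by
    rw [← hr]
    have : δ / 2 * n ^ 2 + D ^ 2 * a ^ 2 / (2 * δ) * r ^ 2 - D * (r * n * a) =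
        (δ * n - D * a * r) ^ 2 / (2 * δ) := by
      field_simp
      ring
    have h2 : 0 ≤ (δ * n - D * a * r) ^ 2 / (2 * δ) := by positivity
    linarith
  have h2 : D ^ 2 * a ^ 2 / (2 * δ) * (C * h * n) ≤
      δ / 2 * n ^ 2 + D ^ 4 * C ^ 2 / (8 * δ ^ 3) * (a ^ 4 * h ^ 2) := by
    have : δ / 2 * n ^ 2 + D ^ 4 * C ^ 2 / (8 * δ ^ 3) * (a ^ 4 * h ^ 2) -
        D ^ 2 * a ^ 2 / (2 * δ) * (C * h * n) =
        δ / 2 * (n - D ^ 2 * a ^ 2 * (C * h) / (2 * δ ^ 2)) ^ 2 := by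
      field_simp
      ring
    have h3 : 0 ≤ δ / 2 * (n - D ^ 2 * a ^ 2 * (C * h) / (2 * δ ^ 2)) ^ 2 := by positivity
    linarith
  linarith

end Inequality

/-! ### The weighted energy and uniqueness -/

section Uniqueness

/-- The differential inequality of the weighted energy `α ‖u‖² + κ²`. -/
theorem weighted_energy_le {ν τ m σ C D M K n a h c s s₀ s₁ κ k : ℝ} (hν : 0 < ν) (hτ : 0 < τ)
    (hm : 0 ≤ m) (hσ : 0 ≤ σ) (hC : 0 ≤ C) (hM : 0 ≤ M) (hn : 0 ≤ n) (ha : 0 ≤ a) (hh : 0 ≤ h)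
    (hc : |c| ≤ D * (√(C * h * n) * n * a)) (hs : 0 ≤ s) (hsM : |s| ≤ M * n * n)
    (hs₀ : |s₀| ≤ M * a * a) (hs₁ : |s₁| ≤ M * a * n) (hκ : |κ| ≤ K) (hk : 0 ≤ k) (hkK : k ≤ K) :
    2 * (1 + 4 * m * τ * M * K ^ 2 / ν) * (-c - ν * n ^ 2 - τ * (κ * s₁ + k * s)) +
      2 * κ * (m * τ * (κ * s₀ + k * (2 * s₁ - s)) - σ * κ) ≤
    (2 * (D ^ 4 * C ^ 2 / (8 * (ν / 4) ^ 3)) +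
        (2 * (1 + 4 * m * τ * M * K ^ 2 / ν) * (τ ^ 2 * M ^ 2 / ν) + 4 * m * τ * M)) *
      (1 + a ^ 4) * ((1 + 4 * m * τ * M * K ^ 2 / ν) * h ^ 2 + κ ^ 2) := by
  -- Dictionary: n = ‖∇u‖, a = ‖∇v₁‖, h = ‖u‖, c = ((u·∇)v₁, u), s = S(u, u), s₀ = S(v₁, v₁), s₁ =
  -- S(v₁, u), k = k₂, m = 1/|Ω|.
  have hK : 0 ≤ K := hk.trans hkK
  set α := 1 + 4 * m * τ * M * K ^ 2 / ν with hα
  have hα0 : 0 < α := by positivity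
  -- The two Young steps use ν/4 each and leave dissipation αν n²; the κ-equation costs 4mτMK² n²
  -- (`h8`). This fixes α, the summand 1 keeping it positive.
  have hαν : 4 * m * τ * M * K ^ 2 ≤ α * ν := by
    rw [hα, add_mul, div_mul_cancel₀ _ hν.ne']
    linarith
  set G := D ^ 4 * C ^ 2 / (8 * (ν / 4) ^ 3)
  have hG : 0 ≤ G := by positivity
  set q := |κ|
  have hq : 0 ≤ q := abs_nonneg κ
  have hq2 : κ ^ 2 = q ^ 2 := (sq_abs κ).symm
  have h1 : -c ≤ ν / 4 * n ^ 2 + G * (a ^ 4 * h ^ 2) :=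
    (neg_le_abs c).trans (hc.trans (young_conv D hC (by positivity) hn hh))
  have h2 : |κ * s₁| ≤ q * (M * a * n) := by
    rw [abs_mul]
    exact mul_le_mul_of_nonneg_left hs₁ hq
  have h3 : -(τ * (κ * s₁)) ≤ ν / 4 * n ^ 2 + τ ^ 2 * M ^ 2 / ν * (q ^ 2 * a ^ 2) := by
    have e1 : -(τ * (κ * s₁)) ≤ τ * (q * (M * a * n)) := by
      rw [← mul_neg]
      exact mul_le_mul_of_nonneg_left ((neg_le_abs _).trans h2) hτ.le
    have e2 : ν / 4 * n ^ 2 + τ ^ 2 * M ^ 2 / ν * (q ^ 2 * a ^ 2) - τ * (q * (M * a * n)) =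
        (ν / 2 * n - τ * M * q * a) ^ 2 / ν := by
      field_simp
      ring
    have e3 : 0 ≤ (ν / 2 * n - τ * M * q * a) ^ 2 / ν := by positivity
    linarith
  have h4 : -c - ν * n ^ 2 - τ * (κ * s₁ + k * s) ≤
      -(ν / 2) * n ^ 2 + G * (a ^ 4 * h ^ 2) + τ ^ 2 * M ^ 2 / ν * (q ^ 2 * a ^ 2) := by
    have : 0 ≤ τ * (k * s) := by positivity
    linarith
  have h5 : κ * (κ * s₀) ≤ M * (q ^ 2 * a ^ 2) := by
    have e1 : κ * (κ * s₀) = q ^ 2 * s₀ := by rw [← hq2]; ring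
    have e2 : q ^ 2 * s₀ ≤ q ^ 2 * (M * a * a) :=
      mul_le_mul_of_nonneg_left ((le_abs_self _).trans hs₀) (sq_nonneg q)
    linarith
  have h6 : 2 * (k * (κ * s₁)) ≤ M * (K ^ 2 * n ^ 2 + q ^ 2 * a ^ 2) := by
    have e1 : k * (κ * s₁) ≤ K * (q * (M * a * n)) := by
      refine (mul_le_mul_of_nonneg_left ((le_abs_self _).trans h2) hk).trans ?_
      gcongr
    have e2 : 0 ≤ M * (K * n - q * a) ^ 2 := by positivity
    linarith
  have h7 : -(κ * (k * s)) ≤ K * (K * (M * n * n)) := by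
    have : |κ * (k * s)| ≤ K * (K * (M * n * n)) := by
      rw [abs_mul, abs_mul, abs_of_nonneg hk]
      gcongr
    exact (neg_le_abs _).trans this
  have h8 : 2 * κ * (m * τ * (κ * s₀ + k * (2 * s₁ - s)) - σ * κ) ≤
      4 * m * τ * M * K ^ 2 * n ^ 2 + 4 * m * τ * M * (q ^ 2 * a ^ 2) := by
    have e1 : κ * (κ * s₀) + 2 * (k * (κ * s₁)) + -(κ * (k * s)) ≤
        2 * (M * (K ^ 2 * n ^ 2 + q ^ 2 * a ^ 2)) := by linarith
    have e2 := mul_le_mul_of_nonneg_left e1 (by positivity : 0 ≤ 2 * (m * τ))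
    have e3 : 0 ≤ σ * κ ^ 2 := by positivity
    linarith
  set Q := 2 * α * (τ ^ 2 * M ^ 2 / ν) + 4 * m * τ * M
  have hQ : 0 ≤ Q := by positivity
  have h9 := mul_le_mul_of_nonneg_left h4 (by positivity : 0 ≤ 2 * α)
  have h10 := mul_le_mul_of_nonneg_right hαν (sq_nonneg n)
  -- Brings the quadratic terms in a under the same Grönwall kernel as the convection term.
  have ha2 : a ^ 2 ≤ 1 + a ^ 4 := by nlinarith [sq_nonneg (a ^ 2 - 1)]
  have h11 : Q * (q ^ 2 * a ^ 2) ≤ Q * ((1 + a ^ 4) * (α * h ^ 2 + q ^ 2)) := by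
    refine mul_le_mul_of_nonneg_left ?_ hQ
    rw [mul_comm]
    exact mul_le_mul ha2 (le_add_of_nonneg_left (by positivity)) (by positivity) (by positivity)
  have h12 : 2 * G * (a ^ 4 * (α * h ^ 2)) ≤ 2 * G * ((1 + a ^ 4) * (α * h ^ 2 + q ^ 2)) := by
    refine mul_le_mul_of_nonneg_left ?_ (by positivity)
    exact mul_le_mul (by linarith) (le_add_of_nonneg_right (by positivity)) (by positivity)
      (by positivity)
  rw [hq2]
  have h13 : Q * (q ^ 2 * a ^ 2) = 2 * α * (τ ^ 2 * M ^ 2 / ν * (q ^ 2 * a ^ 2)) +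
      4 * m * τ * M * (q ^ 2 * a ^ 2) := by ring
  calc _ ≤ 2 * α * (-(ν / 2) * n ^ 2 + G * (a ^ 4 * h ^ 2) +
          τ ^ 2 * M ^ 2 / ν * (q ^ 2 * a ^ 2)) +
        (4 * m * τ * M * K ^ 2 * n ^ 2 + 4 * m * τ * M * (q ^ 2 * a ^ 2)) := add_le_add h9 h8
    _ ≤ 2 * G * (a ^ 4 * (α * h ^ 2)) + Q * (q ^ 2 * a ^ 2) := by
        rw [h13]
        linarith
    _ ≤ _ := by linarith

theorem norm_dcomp_le_norm (u : V Ω) (i j : Fin d) : ‖dcomp u i j‖ ≤ ‖u‖ :=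
  ((norm_le_pi_norm (u.1.2 i) j).trans (norm_le_pi_norm u.1.2 i)).trans (norm_snd_le u.1)

theorem gradNorm_sq_le (u : V Ω) : gradNorm u ^ 2 ≤ d * d * ‖u‖ ^ 2 := by
  rw [gradNorm_sq]
  refine (Finset.sum_le_sum fun i _ => Finset.sum_le_sum fun j _ =>
    pow_le_pow_left₀ (norm_nonneg _) (norm_dcomp_le_norm u i j) 2).trans_eq ?_
  simp only [Finset.sum_const, Finset.card_univ, Fintype.card_fin, nsmul_eq_mul]
  ring

theorem integrable_symForm_self (A : L2 Ω →L[ℝ] L2 Ω) {T : ℝ} {v : ℝ → V Ω}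
    (hv : MemLp v 2 (volume.restrict (Icc 0 T))) :
    Integrable (fun t => symForm A (v t) (v t)) (volume.restrict (Icc 0 T)) := by
  have h1 : Integrable (fun t => ‖v t‖ ^ 2) (volume.restrict (Icc 0 T)) :=
    hv.norm.integrable_sq
  refine (h1.const_mul (d * d * ‖A‖ * (d * d))).mono'
    ((continuous_symForm_self A).comp_aestronglyMeasurable hv.1)
    (Eventually.of_forall fun t => ?_)
  rw [Real.norm_eq_abs]
  calc |symForm A (v t) (v t)| ≤ d * d * ‖A‖ * gradNorm (v t) * gradNorm (v t) :=
        abs_symForm_le A (v t) (v t)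
    _ = d * d * ‖A‖ * gradNorm (v t) ^ 2 := by ring
    _ ≤ d * d * ‖A‖ * (d * d * ‖v t‖ ^ 2) := by
        gcongr
        exact gradNorm_sq_le _
    _ = _ := by ring

/-- The turbulent kinetic energy stays nonnegative. -/
theorem IsStrongSolution.nonneg {A : L2 Ω →L[ℝ] L2 Ω}
    (hA : ∀ f, A f =ᵐ[volume.restrict Ω] fun x => mu Ω x * f x) {ν τ T k₀ : ℝ} (hT : 0 ≤ T)
    (hk₀ : 0 ≤ k₀) {f : ℝ → Fin d → L2 Ω} {v₀ : Fin d → L2 Ω} {v : ℝ → V Ω} {k : ℝ → ℝ}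
    (h : IsStrongSolution Ω ν τ T f v₀ k₀ v k) : ∀ t ∈ Icc 0 T, 0 ≤ k t := by
  intro t ht
  have hg : Integrable (fun t => 1 / volume.real Ω * τ * symForm A (v t) (v t) - √2 / 2 * τ⁻¹)
      (volume.restrict (Icc 0 T)) :=
    ((integrable_symForm_self A h.memLp).const_mul _).sub (integrable_const _)
  -- The k-equation is linear in k with an integrable coefficient, because v ∈ L²(0,T;V); Grönwall
  -- applies to -k with equality.
  have := nonpos_of_ae_deriv_le_mul hT h.k_ac.fun_neg
    (by rw [h.k_init]; linarith) hg (h.k_eq.mono fun t ht => ht.fun_neg)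
    (Eventually.of_forall fun t => by
      rw [dissip_eq hA]
      exact le_of_eq (by ring)) t ht
  linarith

/-- The weak formulation of the difference of two solutions. -/
theorem pair_sub_eq_integral {T : ℝ} {v₀ : Fin d → L2 Ω} {v₁ v₂ : ℝ → V Ω}
    {g₁ g₂ : ℝ → StrongDual ℝ (V Ω)} (hg₁ : MemLp g₁ 2 (volume.restrict (Icc 0 T)))
    (hg₂ : MemLp g₂ 2 (volume.restrict (Icc 0 T)))
    (h₁ : ∀ᵐ t ∂(volume.restrict (Icc 0 T)), ∀ w : V Ω,
      pair (comp (v₁ t)) w = pair v₀ w + ∫ s in (0 : ℝ)..t, g₁ s w)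
    (h₂ : ∀ᵐ t ∂(volume.restrict (Icc 0 T)), ∀ w : V Ω,
      pair (comp (v₂ t)) w = pair v₀ w + ∫ s in (0 : ℝ)..t, g₂ s w) :
    ∀ᵐ t ∂(volume.restrict (Icc 0 T)), ∀ w : V Ω,
      pair (comp (v₁ t - v₂ t)) w = ∫ s in (0 : ℝ)..t, (g₁ s - g₂ s) w := by
  filter_upwards [h₁, h₂, ae_restrict_mem measurableSet_Icc] with t h1 h2 ht w
  have hi : ∀ {g : ℝ → StrongDual ℝ (V Ω)}, MemLp g 2 (volume.restrict (Icc 0 T)) →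
      IntervalIntegrable (fun s => g s w) volume 0 t := fun hg =>
    intervalIntegrable_of_integrable_Icc
      ((hg.integrable (by norm_num)).apply_continuousLinearMap w) ht
  have h3 : pair (comp (v₁ t - v₂ t)) w = pair (comp (v₁ t)) w - pair (comp (v₂ t)) w := by
    simp only [pair_eq_inner, comp_sub, inner_sub_left, Finset.sum_sub_distrib]
  rw [h3, h1, h2]
  simp only [sub_apply]
  rw [intervalIntegral.integral_sub (hi hg₁) (hi hg₂)]
  ring

/-- A strong solution whose gradient is in `L⁴(0,T;L²)` is the only strong solution with its
data. -/
theorem IsStrongSolution.unique (hd : d = 2 ∨ d = 3) (hΩo : IsOpen Ω)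
    (hΩb : Bornology.IsBounded Ω) {ν τ T k₀ : ℝ} (hν : 0 < ν) (hτ : 0 < τ) (hT : 0 < T)
    (hk₀ : 0 ≤ k₀) {f : ℝ → Fin d → L2 Ω} {v₀ : Fin d → L2 Ω} {v₁ v₂ : ℝ → V Ω} {k₁ k₂ : ℝ → ℝ}
    (h₁ : IsStrongSolution Ω ν τ T f v₀ k₀ v₁ k₁)
    (hreg : IntegrableOn (fun t => gradNorm (v₁ t) ^ 4) (Icc 0 T))
    (h₂ : IsStrongSolution Ω ν τ T f v₀ k₀ v₂ k₂) :
    (∀ᵐ t ∂(volume.restrict (Icc 0 T)), v₁ t = v₂ t) ∧ ∀ t ∈ Icc 0 T, k₁ t = k₂ t := by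
  obtain ⟨C, E, hC, hE, hEC⟩ := exists_embedding_four hd hΩb
  obtain ⟨A, hA⟩ := exists_mul_mu hΩo hΩb
  obtain ⟨g₁, hg₁, hi₁, hm₁⟩ := h₁.momentum
  obtain ⟨g₂, hg₂, hi₂, hm₂⟩ := h₂.momentum
  have hk₂ := h₂.nonneg hA hT.le hk₀
  have hκac : AbsolutelyContinuousOnInterval (fun t => k₁ t - k₂ t) 0 T := h₁.k_ac.fun_sub h₂.k_ac
  obtain ⟨K₁, hK₁⟩ := hκac.exists_bound
  obtain ⟨K₂, hK₂⟩ := h₂.k_ac.exists_bound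
  rw [uIcc_of_le hT.le] at hK₁ hK₂
  set K := max K₁ K₂
  have hgm : MemLp (fun t => g₁ t - g₂ t) 2 (volume.restrict (Icc 0 T)) := hg₁.sub hg₂
  have hum : MemLp (fun t => v₁ t - v₂ t) 2 (volume.restrict (Icc 0 T)) := h₁.memLp.sub h₂.memLp
  have hen := energy_eq_integral hΩo hum hgm (pair_sub_eq_integral hg₁ hg₂ hi₁ hi₂)
  have hgu : Integrable (fun t => (g₁ t - g₂ t) (v₁ t - v₂ t)) (volume.restrict (Icc 0 T)) := by
    refine (hgm.norm.integrable_mul hum.norm).mono'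
      (isBoundedBilinearMap_apply.continuous.comp_aestronglyMeasurable (hgm.1.prodMk hum.1))
      (Eventually.of_forall fun t => ?_)
    exact ContinuousLinearMap.le_opNorm _ _
  set m := 1 / volume.real Ω
  have hm : 0 ≤ m := by positivity
  set M := d * d * ‖A‖
  have hM : 0 ≤ M := by positivity
  set α := 1 + 4 * m * τ * M * K ^ 2 / ν
  have hα : 0 < α := by positivity
  set G := 2 * (((d : ℝ) * d) ^ 4 * C ^ 2 / (8 * (ν / 4) ^ 3)) +
    (2 * α * (τ ^ 2 * M ^ 2 / ν) + 4 * m * τ * M)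
  -- The integral replaces ‖u‖², which equals twice it only for almost every t: `y` is then
  -- absolutely continuous and vanishes at 0.
  set y : ℝ → ℝ := fun t => 2 * α * (∫ s in (0 : ℝ)..t, (g₁ s - g₂ s) (v₁ s - v₂ s)) +
    (k₁ t - k₂ t) * (k₁ t - k₂ t)
  have hyac : AbsolutelyContinuousOnInterval y 0 T :=
    ((absolutelyContinuousOnInterval_primitive hT.le hgu).const_mul (2 * α)).fun_add
      (hκac.fun_mul hκac)
  have hye : ∀ᵐ t ∂(volume.restrict (Icc 0 T)),
      y t = α * energy (v₁ t - v₂ t) + (k₁ t - k₂ t) ^ 2 := by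
    filter_upwards [hen] with t ht
    rw [ht]
    ring
  have hgi : ∀ᵐ t ∂(volume.restrict (Icc 0 T)), HasDerivAt
      (fun t => ∫ s in (0 : ℝ)..t, (g₁ s - g₂ s) (v₁ s - v₂ s))
      ((g₁ t - g₂ t) (v₁ t - v₂ t)) t := by
    rw [ae_restrict_iff' measurableSet_Icc]
    filter_upwards [(intervalIntegrable_of_integrable_Icc hgu
      ⟨hT.le, le_rfl⟩).ae_hasDerivAt_integral] with x hx hx'
    exact hx (by rwa [uIcc_of_le hT.le]) 0 (by simp)
  set κ' : ℝ → ℝ := fun t => (dissip Ω τ (k₁ t) (v₁ t) - √2 / 2 * τ⁻¹ * k₁ t) -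
    (dissip Ω τ (k₂ t) (v₂ t) - √2 / 2 * τ⁻¹ * k₂ t)
  have hκ' : ∀ᵐ t ∂(volume.restrict (Icc 0 T)), HasDerivAt (fun t => k₁ t - k₂ t) (κ' t) t := by
    filter_upwards [h₁.k_eq, h₂.k_eq] with t h1 h2 using h1.sub h2
  have hy0 : ∀ t ∈ Icc 0 T, y t ≤ 0 := by
    refine nonpos_of_ae_deriv_le_mul (g := fun t => G * (1 + gradNorm (v₁ t) ^ 4))
      (y' := fun t => 2 * α * ((g₁ t - g₂ t) (v₁ t - v₂ t)) + 2 * (k₁ t - k₂ t) * κ' t)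
      hT.le hyac ?_ (((integrable_const 1).add hreg).const_mul G) ?_ ?_
    · simp [y, h₁.k_init, h₂.k_init]
    · filter_upwards [hgi, hκ'] with t h1 h2
      refine ((h1.const_mul (2 * α)).fun_add (h2.fun_mul h2)).congr_deriv ?_
      ring
    · filter_upwards [hye, hm₁, hm₂, ae_restrict_mem measurableSet_Icc] with t h0 h1 h2 ht
      have e1 := h1 (v₁ t - v₂ t)
      have e2 := h2 (v₁ t - v₂ t)
      have e3 := conv_sub_conv hE (v₁ t) (v₂ t)
      rw [visc_eq hA] at e1 e2
      have e4 := symForm_id_self (v₁ t - v₂ t)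
      rw [symForm_sub_left] at e4
      set u := v₁ t - v₂ t with hu
      -- Eliminating v₂ leaves forms in v₁ and u only, so its gradient never enters the bounds.
      have hv₂ : v₂ t = v₁ t - u := by rw [hu, sub_sub_cancel]
      have hcomm := symForm_comm (inner_mul_mu_comm hA) (v₁ t) u
      have s1 : symForm A (v₂ t) u = symForm A (v₁ t) u - symForm A u u := by
        rw [hv₂, symForm_sub_left]
      have s2 : symForm A (v₂ t) (v₂ t) =
          symForm A (v₁ t) (v₁ t) - 2 * symForm A (v₁ t) u + symForm A u u := by
        rw [hv₂, symForm_sub_left A (v₁ t) u (v₁ t - u), symForm_sub_right A (v₁ t) (v₁ t) u,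
          symForm_sub_right A u (v₁ t) u, ← hcomm]
        ring
      have d1 : (g₁ t - g₂ t) u = -conv u (v₁ t) u - ν * gradNorm u ^ 2 -
          τ * ((k₁ t - k₂ t) * symForm A (v₁ t) u + k₂ t * symForm A u u) := by
        rw [sub_apply]
        rw [s1] at e2
        linear_combination e1 - e2 - e3 - 2 * ν * e4
      have d2 : κ' t = m * τ * ((k₁ t - k₂ t) * symForm A (v₁ t) (v₁ t) +
          k₂ t * (2 * symForm A (v₁ t) u - symForm A u u)) -
            √2 / 2 * τ⁻¹ * (k₁ t - k₂ t) := by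
        simp only [κ']
        rw [dissip_eq hA, dissip_eq hA, s2]
        ring
      have hfin := weighted_energy_le (D := d * d) hν hτ hm (σ := √2 / 2 * τ⁻¹) (by positivity) hC
        hM (gradNorm_nonneg u) (gradNorm_nonneg (v₁ t)) (Real.sqrt_nonneg (energy u))
        (abs_conv_le hE hC hEC u (v₁ t)) (symForm_self_nonneg (inner_mul_mu_self_nonneg hA) u)
        (abs_symForm_le A u u) (abs_symForm_le A (v₁ t) (v₁ t)) (abs_symForm_le A (v₁ t) u)
        ((hK₁ t ht).trans (le_max_left K₁ K₂)) (hk₂ t ht)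
        ((le_abs_self _).trans ((hK₂ t ht).trans (le_max_right K₁ K₂)))
      rw [Real.sq_sqrt (energy_nonneg u)] at hfin
      rw [h0, d1, d2]
      exact hfin
  have hv : ∀ᵐ t ∂(volume.restrict (Icc 0 T)), v₁ t = v₂ t := by
    filter_upwards [hye, ae_restrict_mem measurableSet_Icc] with t h1 ht
    have h2 := hy0 t ht
    rw [h1] at h2
    have h3 := energy_nonneg (v₁ t - v₂ t)
    refine sub_eq_zero.1 (eq_zero_of_energy_eq_zero hΩo (le_antisymm ?_ h3))
    nlinarith [sq_nonneg (k₁ t - k₂ t)]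
  refine ⟨hv, fun t ht => ?_⟩
  -- As v₁ = v₂ almost everywhere, the integral in `y` vanishes at every t, so y = κ² ≤ 0 gives
  -- equality of k₁ and k₂ at every time.
  have h0 : ∫ s in (0 : ℝ)..t, (g₁ s - g₂ s) (v₁ s - v₂ s) = 0 := by
    rw [intervalIntegral.integral_of_le ht.1]
    refine integral_eq_zero_of_ae (ae_restrict_of_ae_restrict_of_subset
      (Ioc_subset_Icc_self.trans (Icc_subset_Icc_right ht.2)) ?_)
    filter_upwards [hv] with s hs
    rw [hs, sub_self, map_zero, Pi.zero_apply]
  have h1 := hy0 t ht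
  simp only [y, h0, mul_zero, zero_add] at h1
  exact sub_eq_zero.1 (mul_self_eq_zero.1 (le_antisymm h1 (mul_self_nonneg _)))

end Uniqueness
end HalfEq

end

/-- A strong solution `(v₁, k₁)` with `∫_0^T ‖∇v₁‖⁴ dt < ∞` is the only strong solution with its
data. -/
theorem theorem3p1 {d : ℕ} (hd : d = 2 ∨ d = 3)
    (Ω : Set (HalfEq.Space d)) (hΩo : IsOpen Ω) (hΩb : Bornology.IsBounded Ω) (hΩn : Ω.Nonempty)
    (ν τ T : ℝ) (hν : 0 < ν) (hτ : 0 < τ) (hT : 0 < T)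
    (f : ℝ → Fin d → HalfEq.L2 Ω) (hf : MemLp f 2 (volume.restrict (Icc 0 T)))
    (v₀ : Fin d → HalfEq.L2 Ω) (k₀ : ℝ) (hk₀ : 0 ≤ k₀)
    (v₁ : ℝ → HalfEq.V Ω) (k₁ : ℝ → ℝ)
    (h₁ : HalfEq.IsStrongSolution Ω ν τ T f v₀ k₀ v₁ k₁)
    (hreg : IntegrableOn (fun t => HalfEq.gradNorm (v₁ t) ^ 4) (Icc 0 T))
    (v₂ : ℝ → HalfEq.V Ω) (k₂ : ℝ → ℝ)
    (h₂ : HalfEq.IsStrongSolution Ω ν τ T f v₀ k₀ v₂ k₂) :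
    (∀ᵐ t ∂(volume.restrict (Icc 0 T)), v₁ t = v₂ t) ∧ ∀ t ∈ Icc 0 T, k₁ t = k₂ t :=
  h₁.unique hd hΩo hΩb hν hτ hT hk₀ hreg h₂
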